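/- All Hilbert spaces are finite dimensional, complex, and equipped with a fixed orthonormal basis; $\log$ is to base $2$ and $\log 0=-\infty$. For $\rho_{AB}\ge 0$ with $\operatorname{tr}\rho\le 1$ let $$H_{\min}(A|B)_\rho=\sup_{\sigma_B\ge 0,\ \operatorname{tr}\sigma_B=1}\ \sup\{\lambda\in\mathbb R:\ \rho_{AB}\le 2^{-\lambda}\,\mathbb 1_A\otimes\sigma_B\},\qquad H^{\varepsilon}_{\min}(A|B)_\rho=\sup_{\tilde\rho}H_{\min}(A|B)_{\tilde\rho},$$ where $\tilde\rho_{AB}\ge 0$ ranges over the operators with $\operatorname{tr}\tilde\rho\le1$ and $P(\rho,\tilde\rho)\le\varepsilon$. Here $P(\rho,\tilde\rho)=\sqrt{1-\bar F(\rho,\tilde\rho)^2}$ is the purified distance, with $\bar F(\rho,\tilde\rho)=\|\sqrt{\rho}\sqrt{\tilde\rho}\|_1+\sqrt{(1-\operatorname{tr}\rho)(1-\operatorname{tr}\tilde\rho)}$. For a purification $\rho_{ABC}$ of $\rho_{AB}$ let $H_{\max}(A|B)_\rho=-H_{\min}(A|C)_\rho$ and $H^{\varepsilon}_{\max}(A|B)_\rho=-H^{\varepsilon}_{\min}(A|C)_\rho$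 (these do not depend on the purification). For a probability distribution $p$ on a finite set $\mathcal M$, $H_{\max}(M)_p$ is the max-entropy of $\sum_{i}p_i|i\rangle\langle i|_M$ with trivial conditioning system. Let $\mathcal T_{A\to B}$ be a classical-quantum channel, i.e. a completely positive trace-preserving map whose Choi–Jamiołkowski state $\omega_{AB}=\frac1{d_A}\sum_{i,j}|i\rangle\langle j|\otimes\mathcal T(|i\rangle\langle j|)$, $d_A=\dim\mathcal H_A$, has the form $\sum_i|i\rangle\langle i|\otimes\sigma_i$ with Hermitian $\sigma_i$. Let $\mathcal M$ be a finite set of messages with $|\mathcal M|\le d_A$, let $p$ be a probability distribution on $\mathcal M$, and let $p_e\ge0$. Suppose that $$H_{\max}(M)_p\ \le\ \log d_A-H^{\varepsilon}_{\max}(A|B)_\omega-1+2\log\!\big(p_e^2-8\varepsilon\big)$$ for some $\varepsilon$ with $0\le\varepsilon\le p_e^2/8$. Then there exist an encoder $\mathcal E_{M\to A}$ and a decoder $\mathcal D_{B\to\widehat M}$ (completely positive trace-preserving maps, where $\mathcal H_M$ and $\mathcal H_{\widehat M}$ have orthonormal basis indexed by $\mathcal M$) whose error probability is at most $p_e$,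 that is, $$\tfrac12\Big\|(\mathcal D\circ\mathcal T\circ\mathcal E\otimes\mathcal I_R)(\varphi_{MR})-\varphi_{\widehat MR}\Big\|_1\le p_e,\qquad \varphi_{MR}=\sum_{i\in\mathcal M}p_i\,|ii\rangle\langle ii|_{MR}.$$ -/

import Mathlib

open scoped Kronecker ComplexOrder

namespace OneShot

noncomputable section

/-! Finite-dimensional Hilbert spaces with a fixed orthonormal basis are indexed by finite types:
operators on `H_A` are matrices `Matrix A A ℂ`, and `H_A ⊗ H_B` is indexed by `A × B`.
All logarithms are to base two. Entropies take values in the extended reals. -/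

/-- Normalized states: positive semidefinite matrices of trace one. -/
def IsState {A : Type*} [Fintype A] (ρ : Matrix A A ℂ) : Prop :=
  ρ.PosSemidef ∧ ρ.trace = 1

/-- Subnormalized states: positive semidefinite matrices of trace at most one. -/
def IsSubState {A : Type*} [Fintype A] (ρ : Matrix A A ℂ) : Prop :=
  ρ.PosSemidef ∧ ρ.trace.re ≤ 1

/-- The positive square root of a positive semidefinite matrix (by functional calculus). -/
def msqrt {A : Type*} [Fintype A] [DecidableEq A] (ρ : Matrix A A ℂ) : Matrix A A ℂ :=
  cfc Real.sqrt ρ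

/-- The Schatten 1-norm `‖X‖₁ = tr √(X† X)`. -/
def traceNorm {A : Type*} [Fintype A] [DecidableEq A] (X : Matrix A A ℂ) : ℝ :=
  (msqrt (X.conjTranspose * X)).trace.re

/-- The fidelity `F(ρ, σ) = ‖√ρ √σ‖₁`. -/
def fidelity {A : Type*} [Fintype A] [DecidableEq A] (ρ σ : Matrix A A ℂ) : ℝ :=
  traceNorm (msqrt ρ * msqrt σ)

/-- The generalized fidelity `F(ρ, σ) + √((1 - tr ρ)(1 - tr σ))`. -/
def genFidelity {A : Type*} [Fintype A] [DecidableEq A] (ρ σ : Matrix A A ℂ) : ℝ :=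
  fidelity ρ σ + Real.sqrt ((1 - ρ.trace.re) * (1 - σ.trace.re))

/-- The purified distance on subnormalized states. -/
def purifiedDistance {A : Type*} [Fintype A] [DecidableEq A] (ρ σ : Matrix A A ℂ) : ℝ :=
  Real.sqrt (1 - genFidelity ρ σ ^ 2)

/-- The conditional min-entropy `H_min(A|B)_ρ`: the supremum, over states `σ` of `B`, of the reals
`l` such that `ρ ≤ 2^(-l) 1_A ⊗ σ` in the positive semidefinite order. -/
def minEntropy {A B : Type*} [Fintype A] [DecidableEq A] [Fintype B]
    (ρ : Matrix (A × B) (A × B) ℂ) : EReal :=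
  ⨆ (σ : Matrix B B ℂ) (_ : IsState σ) (l : ℝ)
    (_ : ((((2 : ℝ) ^ (-l) : ℝ) : ℂ) • ((1 : Matrix A A ℂ) ⊗ₖ σ) - ρ).PosSemidef), (l : EReal)

/-- The smooth conditional min-entropy: the largest min-entropy of a subnormalized state within
purified distance `ε` of `ρ`. -/
def smoothMinEntropy {A B : Type*} [Fintype A] [DecidableEq A] [Fintype B] [DecidableEq B]
    (ε : ℝ) (ρ : Matrix (A × B) (A × B) ℂ) : EReal :=
  ⨆ (τ : Matrix (A × B) (A × B) ℂ) (_ : IsSubState τ) (_ : purifiedDistance ρ τ ≤ ε), minEntropy τ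

/-- The canonical purification of a positive semidefinite `ρ` on `AB`: the vector
`∑_{x,c} ⟨x|√ρ|c⟩ |x⟩_{AB} ⊗ |c⟩_C`, where the purifying system `C` is a copy of `AB`. -/
def purification {A B : Type*} [Fintype A] [DecidableEq A] [Fintype B] [DecidableEq B]
    (ρ : Matrix (A × B) (A × B) ℂ) : (A × B) × (A × B) → ℂ :=
  fun z => msqrt ρ z.1 z.2

/-- For a vector `ψ` of `ABC`, the marginal on `AC` of the pure state `|ψ⟩⟨ψ|`. -/
def marginalAC {A B C : Type*} [Fintype B] (ψ : (A × B) × C → ℂ) :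
    Matrix (A × C) (A × C) ℂ :=
  fun x y => ∑ b, ψ ((x.1, b), x.2) * star (ψ ((y.1, b), y.2))

/-- The conditional max-entropy `H_max(A|B)_ρ = -H_min(A|C)_ρ`, for a purification `ρ_{ABC}`.
The value is the same for every purification; the canonical one is used. -/
def maxEntropy {A B : Type*} [Fintype A] [DecidableEq A] [Fintype B] [DecidableEq B]
    (ρ : Matrix (A × B) (A × B) ℂ) : EReal :=
  - minEntropy (marginalAC (purification ρ))

/-- The smooth conditional max-entropy, minus the smooth min-entropy of `A` given the purifying
system of a purification. The value is the same for every purification; the canonical one is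
used. -/
def smoothMaxEntropy {A B : Type*} [Fintype A] [DecidableEq A] [Fintype B] [DecidableEq B]
    (ε : ℝ) (ρ : Matrix (A × B) (A × B) ℂ) : EReal :=
  - smoothMinEntropy ε (marginalAC (purification ρ))

/-- `H_max(M)_p`: the (unconditional) max-entropy of the classical state `∑ p_i |i⟩⟨i|`, that is,
the conditional max-entropy with a trivial conditioning system. -/
def maxEntropyOfDistribution {M : Type*} [Fintype M] [DecidableEq M] (p : M → ℝ) : EReal :=
  maxEntropy (Matrix.diagonal fun x : M × Unit => ((p x.1 : ℝ) : ℂ))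

/-- Base-two logarithm of a nonnegative real, with `log 0 = -∞`. -/
def log2 (x : ℝ) : EReal :=
  if x ≤ 0 then ⊥ else ((Real.logb 2 x : ℝ) : EReal)

/-- `(T ⊗ id_R)(X)` for a linear map `T` from operators on `A` to operators on `B`. -/
def applyFst {A B : Type*} (R : Type*) (T : Matrix A A ℂ →ₗ[ℂ] Matrix B B ℂ)
    (X : Matrix (A × R) (A × R) ℂ) : Matrix (B × R) (B × R) ℂ :=
  fun x y => T (fun a a' => X (a, x.2) (a', y.2)) x.1 y.1

/-- Quantum channels: completely positive trace preserving linear maps. -/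
structure IsChannel {A B : Type*} [Fintype A] [Fintype B]
    (T : Matrix A A ℂ →ₗ[ℂ] Matrix B B ℂ) : Prop where
  completelyPositive : ∀ (k : ℕ) (X : Matrix (A × Fin k) (A × Fin k) ℂ),
    X.PosSemidef → (applyFst (Fin k) T X).PosSemidef
  tracePreserving : ∀ X : Matrix A A ℂ, (T X).trace = X.trace

/-- The Choi-Jamiolkowski representation
`ω = (1/d_A) ∑_{i,j} |i⟩⟨j|_{A'} ⊗ T(|i⟩⟨j|)`, with the copy `A'` of the input written first. -/
def choi {A B : Type*} [Fintype A] [DecidableEq A]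
    (T : Matrix A A ℂ →ₗ[ℂ] Matrix B B ℂ) : Matrix (A × B) (A × B) ℂ :=
  ((Fintype.card A : ℂ)⁻¹) •
    ∑ i : A, ∑ j : A, Matrix.single i j (1 : ℂ) ⊗ₖ T (Matrix.single i j 1)

/-- `ρ_{AB}` is classical on `A` with respect to the fixed basis:
`ρ = ∑_i |i⟩⟨i| ⊗ σ_i` with Hermitian `σ_i`. -/
def IsClassicalOnFst {A B : Type*} [Fintype A] [DecidableEq A]
    (ρ : Matrix (A × B) (A × B) ℂ) : Prop :=
  ∃ σ : A → Matrix B B ℂ, (∀ i, (σ i).IsHermitian) ∧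
    ρ = ∑ i, Matrix.single i i (1 : ℂ) ⊗ₖ σ i

/-- A classical-quantum (CQ) channel: a channel whose Choi-Jamiolkowski representation is
classical on the copy of the input system. -/
def IsCQChannel {A B : Type*} [Fintype A] [DecidableEq A] [Fintype B]
    (T : Matrix A A ℂ →ₗ[ℂ] Matrix B B ℂ) : Prop :=
  IsChannel T ∧ IsClassicalOnFst (choi T)

/-- The state `∑_i p_i |ii⟩⟨ii|` of a message distributed according to `p` and a perfectly
correlated classical reference. -/
def correlatedState {M : Type*} [DecidableEq M] (p : M → ℝ) : Matrix (M × M) (M × M) ℂ :=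
  Matrix.diagonal fun x => if x.1 = x.2 then ((p x.1 : ℝ) : ℂ) else 0

/-- The error probability of the encoder `E` and the decoder `D` for the channel `T` and messages
distributed according to `p`: half of the trace norm
`‖((D ∘ T ∘ E) ⊗ id_R)(φ) - φ‖₁`, where `φ = ∑_i p_i |ii⟩⟨ii|`. -/
def errorProbability {M A B : Type*} [Fintype M] [DecidableEq M]
    (p : M → ℝ) (E : Matrix M M ℂ →ₗ[ℂ] Matrix A A ℂ) (T : Matrix A A ℂ →ₗ[ℂ] Matrix B B ℂ)
    (D : Matrix B B ℂ →ₗ[ℂ] Matrix M M ℂ) : ℝ :=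
  (1 / 2) * traceNorm
    (applyFst M (D ∘ₗ T ∘ₗ E) (correlatedState p) - correlatedState p)

end

end OneShot

/-! The proof is random coding with a pretty good measurement. Classicality makes the Choi state d⁻¹
∑ |a⟩⟨a| ⊗ ρ_a, so it suffices to find codewords f : M → A and a measurement of the states ρ_{f m}.

Decoding: for the ensemble p_i ρ_{f i} and any projective tests L_i, the pretty good measurement has
error at most ∑_i (p_i tr ρ_{f i}(1 - L_i) + ∑_{j≠i} p_j tr ρ_{f j} L_i) (`exists_measurement`).
Averaging over independent uniform codewords turns the inner sum into (1 - p_i) tr ρ̄ L_i with ρ̄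
the average state (`exists_code_le_average`), so L_i should test p_i ρ_a against (1 - p_i) ρ̄. A
test of two operators has error at most the trace of the product of their square roots
(`exists_test`). This produces √p_i, hence H_max(M) = 2 log ∑ √p_i.

Entropy: Uhlmann's theorem replaces √ρ_a by amplitudes K_a close to it on average, read off from a
subnormalized purification of the smoothed state τ on AC. The inequality τ ≤ 2^{-l} 1 ⊗ σ and
Cauchy-Schwarz bound the summed overlaps with √ρ̄ by √d 2^{-l/2} (`exists_smoothed_amplitude`).
Testing K_a K_a† in place of ρ_a costs 3ε (`exists_tests`). The error is at most d^{-1/2} 2^{-l/2} ∑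
√p_i + 3ε (`exists_code`), and the hypothesis makes this at most p_e² - 8ε + 3ε. -/

open scoped Kronecker ComplexOrder

namespace OneShot

open Matrix

/-! ### Square roots, pseudo-inverses and spectral projections. -/

section FunctionalCalculus

variable {n : Type*} [Fintype n] [DecidableEq n]

theorem continuousOn_spectrum (H : Matrix n n ℂ) (f : ℝ → ℝ) : ContinuousOn f (spectrum ℝ H) :=
  Matrix.finite_real_spectrum.continuousOn f

theorem cfc_mul_cfc (H : Matrix n n ℂ) (f g : ℝ → ℝ) :
    cfc f H * cfc g H = cfc (fun x => f x * g x) H :=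
  (cfc_mul f g H (continuousOn_spectrum H f) (continuousOn_spectrum H g)).symm

theorem isHermitian_cfc (H : Matrix n n ℂ) (f : ℝ → ℝ) : (cfc f H).IsHermitian :=
  cfc_predicate f H

open scoped MatrixOrder in
theorem posSemidef_cfc (H : Matrix n n ℂ) {f : ℝ → ℝ} (hf : ∀ x ∈ spectrum ℝ H, 0 ≤ f x) :
    (cfc f H).PosSemidef :=
  Matrix.nonneg_iff_posSemidef.1 (cfc_nonneg hf)

open scoped MatrixOrder in
theorem spectrum_nonneg_of_posSemidef {H : Matrix n n ℂ} (hH : H.PosSemidef) :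
    ∀ x ∈ spectrum ℝ H, 0 ≤ x :=
  fun _ hx => spectrum_nonneg_of_nonneg (Matrix.nonneg_iff_posSemidef.2 hH) hx

theorem posSemidef_msqrt (H : Matrix n n ℂ) : (msqrt H).PosSemidef :=
  posSemidef_cfc H fun x _ => Real.sqrt_nonneg x

theorem msqrt_mul_self {H : Matrix n n ℂ} (hH : H.PosSemidef) : msqrt H * msqrt H = H := by
  have h1 : msqrt H * msqrt H = cfc (fun x : ℝ => x) H := by
    rw [msqrt, cfc_mul_cfc]
    exact cfc_congr fun x hx => Real.mul_self_sqrt (spectrum_nonneg_of_posSemidef hH x hx)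
  rw [h1]
  exact cfc_id' ℝ H hH.isHermitian

theorem msqrt_mul_self_eq {H : Matrix n n ℂ} (hH : H.PosSemidef) : msqrt (H * H) = H := by
  have hs : IsSelfAdjoint H := hH.isHermitian
  have h1 : H * H = cfc (fun x : ℝ => x * x) H := by
    rw [← cfc_mul_cfc, cfc_id' ℝ H hs]
  have h2 : cfc Real.sqrt (cfc (fun x : ℝ => x * x) H) = cfc (fun x => Real.sqrt (x * x)) H :=
    (cfc_comp' Real.sqrt (fun x : ℝ => x * x) H Real.continuous_sqrt.continuousOn
      (continuousOn_spectrum H _) hs).symm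
  rw [msqrt, h1, h2]
  calc _ = cfc (fun x : ℝ => x) H :=
        cfc_congr fun x hx => Real.sqrt_mul_self (spectrum_nonneg_of_posSemidef hH x hx)
    _ = H := cfc_id' ℝ H hs

/-- The square root `msqrt S` has a commuting pseudo-inverse. -/
theorem exists_sqrt_pseudoInverse (S : Matrix n n ℂ) :
    ∃ T : Matrix n n ℂ, T.PosSemidef ∧ T * msqrt S = msqrt S * T ∧
      msqrt S * T * msqrt S = msqrt S ∧ T * msqrt S * T = T := by
  -- The convention `0⁻¹ = 0` makes this the inverse on the support and zero on the kernel.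
  refine ⟨cfc (fun x => (Real.sqrt x)⁻¹) S,
    posSemidef_cfc S fun x _ => inv_nonneg.2 (Real.sqrt_nonneg x), ?_, ?_, ?_⟩
  · rw [msqrt, cfc_mul_cfc, cfc_mul_cfc]
    exact cfc_congr fun x _ => mul_comm _ _
  · rw [msqrt, cfc_mul_cfc, cfc_mul_cfc]
    exact cfc_congr fun x _ => mul_inv_mul_cancel _
  · rw [msqrt, cfc_mul_cfc, cfc_mul_cfc]
    refine cfc_congr fun x _ => ?_
    by_cases hx : Real.sqrt x = 0
    · simp [hx]
    · field_simp

/-- The spectral projection onto the positive part of a Hermitian matrix. -/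
theorem exists_positivePart_projection {D : Matrix n n ℂ} (hD : D.IsHermitian) :
    ∃ L : Matrix n n ℂ, L.IsHermitian ∧ L * L = L ∧
      (L * D).PosSemidef ∧ (-(D * (1 - L))).PosSemidef := by
  have hs : IsSelfAdjoint D := hD
  have hone : (1 : Matrix n n ℂ) = cfc (fun _ : ℝ => (1 : ℝ)) D := (cfc_const_one ℝ D hs).symm
  set p : ℝ → ℝ := fun x => if 0 < x then 1 else 0 with hp
  refine ⟨cfc p D, isHermitian_cfc D _, ?_, ?_, ?_⟩
  · rw [cfc_mul_cfc]
    exact cfc_congr fun x _ => by simp [hp]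
  · have : cfc p D * D = cfc (fun x => p x * x) D := by
      rw [← cfc_mul_cfc, cfc_id' ℝ D hs]
    rw [this]
    refine posSemidef_cfc D fun x _ => ?_
    by_cases hx : 0 < x
    · simp [hp, hx, hx.le]
    · simp [hp, hx]
  · have : -(D * (1 - cfc p D)) = cfc (fun x => -(x * (1 - p x))) D := by
      have h1 : 1 - cfc p D = cfc (fun x => 1 - p x) D := by
        rw [cfc_sub (fun _ => (1 : ℝ)) p D (continuousOn_spectrum D _) (continuousOn_spectrum D _),
          ← hone]
      rw [h1, cfc_neg, ← cfc_mul_cfc (f := fun x => x), cfc_id' ℝ D hs]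
    rw [this]
    refine posSemidef_cfc D fun x _ => ?_
    by_cases hx : 0 < x
    · simp [hp, hx]
    · simp [hp, hx]; linarith

end FunctionalCalculus

/-! ### Trace inequalities and factorization through a square root. -/

section TraceInequalities

variable {n m : Type*} [Fintype n] [Fintype m]

theorem trace_re_nonneg {X : Matrix n n ℂ} (hX : X.PosSemidef) : 0 ≤ X.trace.re :=
  (Complex.nonneg_iff.1 hX.trace_nonneg).1

theorem trace_mul_re_nonneg [DecidableEq n] {X Y : Matrix n n ℂ} (hX : X.PosSemidef)
    (hY : Y.PosSemidef) : 0 ≤ (X * Y).trace.re := by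
  have h : (X * Y).trace = (msqrt X * Y * (msqrt X)ᴴ).trace := by
    conv_lhs => rw [← msqrt_mul_self hX]
    rw [(posSemidef_msqrt X).isHermitian.eq, Matrix.mul_assoc, Matrix.trace_mul_comm]
  rw [h]
  exact trace_re_nonneg (hY.mul_mul_conjTranspose_same _)

theorem trace_conjTranspose_mul (X Y : Matrix n m ℂ) :
    (Xᴴ * Y).trace = star ((Yᴴ * X).trace) := by
  rw [← Matrix.trace_conjTranspose, Matrix.conjTranspose_mul, Matrix.conjTranspose_conjTranspose]

theorem trace_conjTranspose_mul_re_comm (X Y : Matrix n m ℂ) :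
    (Xᴴ * Y).trace.re = (Yᴴ * X).trace.re := by
  rw [trace_conjTranspose_mul]; simp

theorem trace_conjTranspose_mul_self_re_nonneg (X : Matrix n m ℂ) :
    0 ≤ (Xᴴ * X).trace.re :=
  trace_re_nonneg (Matrix.posSemidef_conjTranspose_mul_self X)

theorem trace_conjTranspose_sub_mul_sub_re (X Y : Matrix n m ℂ) :
    ((X - Y)ᴴ * (X - Y)).trace.re =
      (Xᴴ * X).trace.re + (Yᴴ * Y).trace.re - 2 * (Xᴴ * Y).trace.re := by
  have := trace_conjTranspose_mul_re_comm X Y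
  simp only [Matrix.conjTranspose_sub, Matrix.sub_mul, Matrix.mul_sub, Matrix.trace_sub,
    Complex.sub_re]
  linarith

theorem trace_conjTranspose_add_mul_add_re (X Y : Matrix n m ℂ) :
    ((X + Y)ᴴ * (X + Y)).trace.re =
      (Xᴴ * X).trace.re + (Yᴴ * Y).trace.re + 2 * (Xᴴ * Y).trace.re := by
  have := trace_conjTranspose_mul_re_comm X Y
  simp only [Matrix.conjTranspose_add, Matrix.add_mul, Matrix.mul_add, Matrix.trace_add,
    Complex.add_re]
  linarith

theorem two_mul_trace_re_le (X Y : Matrix n m ℂ) :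
    2 * (Xᴴ * Y).trace.re ≤ (Xᴴ * X).trace.re + (Yᴴ * Y).trace.re := by
  have := trace_conjTranspose_mul_self_re_nonneg (X - Y)
  rw [trace_conjTranspose_sub_mul_sub_re] at this
  linarith

/-- The Cauchy-Schwarz inequality for the Hilbert-Schmidt inner product. -/
theorem trace_re_le_sqrt_mul_sqrt (X Y : Matrix n m ℂ) :
    (Xᴴ * Y).trace.re ≤ Real.sqrt (Xᴴ * X).trace.re * Real.sqrt (Yᴴ * Y).trace.re := by
  have key : ∀ t : ℝ, 0 ≤ (Yᴴ * Y).trace.re * (t * t) + (2 * (Xᴴ * Y).trace.re) * t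
      + (Xᴴ * X).trace.re := by
    intro t
    have := trace_conjTranspose_mul_self_re_nonneg (X + (t : ℂ) • Y)
    rw [trace_conjTranspose_add_mul_add_re] at this
    simp [Matrix.conjTranspose_smul, smul_smul] at this
    linarith
  have hd := discrim_le_zero key
  rw [← Real.sqrt_mul (trace_conjTranspose_mul_self_re_nonneg X)]
  apply Real.le_sqrt_of_sq_le
  rw [discrim] at hd
  nlinarith

theorem posSemidef_one_sub_projection [DecidableEq n] {P : Matrix n n ℂ} (hP : P.IsHermitian)
    (hPP : P * P = P) : (1 - P).PosSemidef := by
  have h : 1 - P = (1 - P)ᴴ * (1 - P) := by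
    rw [Matrix.conjTranspose_sub, hP.eq, Matrix.conjTranspose_one]
    simp [Matrix.sub_mul, Matrix.mul_sub, hPP]
  rw [h]
  exact Matrix.posSemidef_conjTranspose_mul_self _

/-- `R†R ≤ c` implies `RR† ≤ c`. -/
theorem posSemidef_sub_mul_conjTranspose [DecidableEq n] [DecidableEq m] {R : Matrix n m ℂ}
    {c : ℝ} (hc : 0 < c) (h : ((c : ℂ) • (1 : Matrix m m ℂ) - Rᴴ * R).PosSemidef) :
    ((c : ℂ) • (1 : Matrix n n ℂ) - R * Rᴴ).PosSemidef := by
  have h1 := h.mul_mul_conjTranspose_same R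
  have h2 := Matrix.posSemidef_self_mul_conjTranspose ((c : ℂ) • (1 : Matrix n n ℂ) - R * Rᴴ)
  have h3 := h1.add h2
  -- The identity R(c - R†R)R† + (c - RR†)² = c(c - RR†) exhibits the target as a sum of positive
  -- terms.
  have h4 : R * ((c : ℂ) • (1 : Matrix m m ℂ) - Rᴴ * R) * Rᴴ +
      ((c : ℂ) • (1 : Matrix n n ℂ) - R * Rᴴ) * ((c : ℂ) • (1 : Matrix n n ℂ) - R * Rᴴ)ᴴ
      = (c : ℂ) • ((c : ℂ) • (1 : Matrix n n ℂ) - R * Rᴴ) := by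
    simp only [Matrix.conjTranspose_sub, Matrix.conjTranspose_smul, Matrix.conjTranspose_one,
      Matrix.conjTranspose_mul, Matrix.conjTranspose_conjTranspose, Matrix.mul_sub, Matrix.sub_mul,
      Matrix.mul_smul, Matrix.smul_mul, Matrix.mul_one, Matrix.one_mul, smul_sub, smul_smul,
      RCLike.star_def, Complex.conj_ofReal, Matrix.mul_assoc]
    abel
  rw [h4] at h3
  have h5 := h3.smul (a := ((c⁻¹ : ℝ) : ℂ)) (by exact_mod_cast (inv_pos.2 hc).le)
  rwa [smul_smul, ← Complex.ofReal_mul, inv_mul_cancel₀ hc.ne', Complex.ofReal_one, one_smul] at h5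

/-- If `NN† ≤ c S` then `N` factors through the square root of `S`. -/
theorem exists_factor_of_le [DecidableEq n] [DecidableEq m] {N : Matrix n m ℂ} {S : Matrix n n ℂ}
    (hS : S.PosSemidef) {c : ℝ} (hc : 0 < c) (h : ((c : ℂ) • S - N * Nᴴ).PosSemidef) :
    ∃ R : Matrix n m ℂ, N = msqrt S * R ∧
      ((c : ℂ) • (1 : Matrix m m ℂ) - Rᴴ * R).PosSemidef := by
  obtain ⟨T, hT, hTS, hSTS, hTST⟩ := exists_sqrt_pseudoInverse S
  have hR := (posSemidef_msqrt S).isHermitian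
  have hRR := msqrt_mul_self hS
  set r := msqrt S
  have hE : (r * T).IsHermitian := by
    rw [Matrix.IsHermitian, Matrix.conjTranspose_mul, hT.isHermitian.eq, hR.eq, hTS]
  have hEE : r * T * (r * T) = r * T := by
    rw [Matrix.mul_assoc, ← Matrix.mul_assoc T r T, hTST]
  -- Sandwiching with 1 - rT kills S and leaves -XX† ≥ 0 for X = (1 - rT)N, so X = 0: the range of N
  -- lies in the support of S.
  have hN : r * T * N = N := by
    have h0 := h.mul_mul_conjTranspose_same (1 - r * T)
    have h1 : (1 - r * T) * ((c : ℂ) • S - N * Nᴴ) * (1 - r * T)ᴴ =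
        -(((1 - r * T) * N) * ((1 - r * T) * N)ᴴ) := by
      have h2 : (1 - r * T) * S = 0 := by
        rw [← hRR, ← Matrix.mul_assoc, Matrix.sub_mul, hSTS, Matrix.one_mul, sub_self,
          Matrix.zero_mul]
      rw [Matrix.mul_sub, Matrix.mul_smul, h2, Matrix.conjTranspose_mul]
      simp [Matrix.mul_assoc]
    rw [h1] at h0
    have h2 := trace_re_nonneg h0
    have h3 := Matrix.posSemidef_self_mul_conjTranspose ((1 - r * T) * N)
    have h4 := h3.trace_nonneg
    have h5 := h0.trace_nonneg
    rw [Matrix.trace_neg] at h5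
    have h6 := le_antisymm (neg_nonneg.1 h5) h4
    rw [Matrix.trace_mul_conjTranspose_self_eq_zero_iff, Matrix.sub_mul, Matrix.one_mul,
      sub_eq_zero] at h6
    exact h6.symm
  refine ⟨T * N, by rw [← Matrix.mul_assoc, hN], ?_⟩
  -- The bound is direct for RR†, since TST is a projection; it is then transferred to R†R.
  suffices h : ((c : ℂ) • (1 : Matrix n n ℂ) - (T * N)ᴴᴴ * (T * N)ᴴ).PosSemidef by
    simpa only [Matrix.conjTranspose_conjTranspose] using posSemidef_sub_mul_conjTranspose hc h
  have h0 := h.mul_mul_conjTranspose_same T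
  have h1 : T * S * T = r * T := by
    calc T * S * T = T * r * (r * T) := by rw [← hRR]; simp only [Matrix.mul_assoc]
      _ = r * T := by rw [hTS, hEE]
  have h2 := (posSemidef_one_sub_projection hE hEE).smul (a := (c : ℂ)) (by exact_mod_cast hc.le)
  convert h2.add h0 using 1
  rw [hT.isHermitian.eq, Matrix.mul_sub, Matrix.sub_mul, Matrix.mul_smul, Matrix.smul_mul, h1,
    Matrix.conjTranspose_conjTranspose, Matrix.conjTranspose_mul, hT.isHermitian.eq, smul_sub]
  simp only [Matrix.mul_assoc]
  abel

end TraceInequalities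

/-! ### Binary tests and the pretty good measurement. -/

section Measurements

variable {n m : Type*} [Fintype n] [DecidableEq n] [Fintype m] [DecidableEq m]

/-- A projective test discriminating `A` from `B` with total error at most `tr √A√B`. -/
theorem exists_test {A B : Matrix n n ℂ} (hA : A.PosSemidef) (hB : B.PosSemidef) :
    ∃ L : Matrix n n ℂ, L.IsHermitian ∧ L * L = L ∧
      (A * (1 - L)).trace.re + (B * L).trace.re ≤ (msqrt A * msqrt B).trace.re := by
  have ha := posSemidef_msqrt A
  have hb := posSemidef_msqrt B
  -- The test projects on the positive part of √A - √B rather than A - B. Pairing with √A and √B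
  -- gives tr A(1 - L) ≤ tr √A√B(1 - L) and tr BL ≤ tr √A√B L.
  obtain ⟨L, hL, hLL, hp, hn⟩ :=
    exists_positivePart_projection (ha.isHermitian.sub hb.isHermitian)
  refine ⟨L, hL, hLL, ?_⟩
  have h1 := trace_mul_re_nonneg ha hn
  have h2 := trace_mul_re_nonneg hb hp
  have hAA := msqrt_mul_self hA
  have hBB := msqrt_mul_self hB
  set a := msqrt A
  set b := msqrt B
  rw [← hAA, ← hBB]
  have h3 : (b * (L * a)).trace = (a * (b * L)).trace := by
    rw [← Matrix.mul_assoc, Matrix.trace_mul_comm]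
  have h4 : (b * (L * b)).trace = (b * (b * L)).trace := by
    rw [← Matrix.mul_assoc, Matrix.trace_mul_comm]
  simp only [Matrix.mul_sub, Matrix.sub_mul, Matrix.mul_neg, Matrix.mul_one, Matrix.trace_sub,
    Matrix.trace_neg, h3, h4, Complex.sub_re, Complex.neg_re, Matrix.mul_assoc] at h1 h2 ⊢
  linarith

omit [DecidableEq n] in
-- In the application r = S^{1/4} and s is its pseudo-inverse, so the right side is the success term
-- tr S^{-1/2} A S^{-1/2} A. It follows from 2 Re⟨X, Y⟩ ≤ ‖X‖² + ‖Y‖² used twice: for sAs and rLr,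
-- whose inner product is tr AL, and for L r² and r² L, which bounds ‖rLr‖² by tr r⁴L.
theorem pgm_term_bound {A L r s : Matrix n n ℂ} (hA : A.IsHermitian) (hL : L.IsHermitian)
    (hLL : L * L = L) (hr : r.IsHermitian) (hs : s.IsHermitian)
    (hEA : r * s * A = A) :
    2 * (A * L).trace.re - (r * r * (r * r) * L).trace.re ≤
      (s * s * A * (s * s) * A).trace.re := by
  have hAE : A * (s * r) = A := by
    have := congrArg Matrix.conjTranspose hEA
    rwa [Matrix.conjTranspose_mul, Matrix.conjTranspose_mul, hA.eq, hr.eq, hs.eq] at this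
  have h1 := two_mul_trace_re_le (s * A * s) (r * L * r)
  have h2 := two_mul_trace_re_le (L * (r * r)) (r * r * L)
  simp only [Matrix.conjTranspose_mul, hA.eq, hL.eq, hr.eq, hs.eq] at h1 h2
  have e1 : (s * (A * s) * (r * L * r)).trace = (A * L).trace := by
    calc _ = (s * (A * (s * r) * L * r)).trace := by simp only [Matrix.mul_assoc]
      _ = (A * L * (r * s)).trace := by
        rw [hAE, Matrix.trace_mul_comm]; simp only [Matrix.mul_assoc]
      _ = (r * s * A * L).trace := by
        rw [Matrix.trace_mul_comm]; simp only [Matrix.mul_assoc]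
      _ = _ := by rw [hEA]
  have e2 : (s * (A * s) * (s * A * s)).trace = (s * s * A * (s * s) * A).trace := by
    rw [Matrix.trace_mul_comm (s * (A * s))]
    calc _ = ((s * A) * (s * s * A * s)).trace := by simp only [Matrix.mul_assoc]
      _ = _ := by rw [Matrix.trace_mul_comm]; simp only [Matrix.mul_assoc]
  have e3 : (r * (L * r) * (r * L * r)).trace = (r * r * L * (r * r * L)).trace := by
    rw [← Matrix.trace_mul_comm (r * r * L)]
    calc _ = (r * (L * (r * (r * (L * r))))).trace := by simp only [Matrix.mul_assoc]
      _ = _ := by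
        rw [Matrix.trace_mul_comm]
        simp only [Matrix.mul_assoc]
        rw [Matrix.trace_mul_comm]
        simp only [Matrix.mul_assoc]
  have e4 : (r * r * L * (L * (r * r))).trace = (r * r * (r * r) * L).trace := by
    calc _ = (r * r * (L * L) * (r * r)).trace := by simp only [Matrix.mul_assoc]
      _ = _ := by rw [hLL, Matrix.trace_mul_comm]; simp only [Matrix.mul_assoc]
  have e5 : (L * (r * r) * (r * r * L)).trace = (r * r * (r * r) * L).trace := by
    rw [Matrix.trace_mul_comm, ← e4]
  rw [e1, e2, e3] at h1
  rw [e4, e5] at h2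
  linarith

/-- The pretty good measurement of the ensemble `A` succeeds at least as well as is suggested by
a union bound for arbitrary projective tests `L i`. -/
theorem exists_measurement {M : Type*} [Fintype M] [DecidableEq M] [Nonempty M]
    {A L : M → Matrix n n ℂ} (hA : ∀ i, (A i).PosSemidef) (hL : ∀ i, (L i).IsHermitian)
    (hLL : ∀ i, L i * L i = L i) :
    ∃ Q : M → Matrix n n ℂ, (∀ i, (Q i).PosSemidef) ∧ ∑ i, Q i = 1 ∧
      ∑ i, (2 * (A i * L i).trace.re - ((∑ j, A j) * L i).trace.re) ≤
        ∑ i, (Q i * A i).trace.re := by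
  have hS : (∑ j, A j).PosSemidef := Matrix.posSemidef_sum _ fun j _ => hA j
  set S := ∑ j, A j with hSdef
  have hR := posSemidef_msqrt S
  have hr := posSemidef_msqrt (msqrt S)
  have hRR := msqrt_mul_self hS
  have hrr := msqrt_mul_self hR
  obtain ⟨s, hs, hsr, hrsr, hsrs⟩ := exists_sqrt_pseudoInverse (msqrt S)
  set r := msqrt (msqrt S)
  rw [← hrr] at hRR
  have hE : (r * s).IsHermitian := by
    rw [Matrix.IsHermitian, Matrix.conjTranspose_mul, hs.isHermitian.eq, hr.isHermitian.eq, hsr]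
  have hEE : r * s * (r * s) = r * s := by
    rw [Matrix.mul_assoc, ← Matrix.mul_assoc s r s, hsrs]
  have hEA : ∀ i, r * s * A i = A i := by
    intro i
    obtain ⟨a, haH⟩ : ∃ a, msqrt (A i) = a := ⟨_, rfl⟩
    have haa : A i = a * aᴴ := by
      rw [← haH, (posSemidef_msqrt (A i)).isHermitian.eq, msqrt_mul_self (hA i)]
    have hle : (((1 : ℝ) : ℂ) • S - a * aᴴ).PosSemidef := by
      rw [← haa, Complex.ofReal_one, one_smul, hSdef, ← Finset.add_sum_erase _ _ (Finset.mem_univ i),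
        add_sub_cancel_left]
      exact Matrix.posSemidef_sum _ fun j _ => hA j
    obtain ⟨X, hX, -⟩ := exists_factor_of_le hS one_pos hle
    rw [haa, hX, ← hrr]
    simp only [← Matrix.mul_assoc]
    rw [hrsr]
  obtain ⟨i₀⟩ := ‹Nonempty M›
  have hC := posSemidef_one_sub_projection hE hEE
  -- The operators S^{-1/2} A_i S^{-1/2} sum only to the support projection rs; the remainder goes
  -- to an arbitrary outcome i₀.
  refine ⟨fun i => s * s * A i * (s * s) + if i = i₀ then 1 - r * s else 0, fun i => ?_, ?_,
    Finset.sum_le_sum fun i _ => ?_⟩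
  · refine Matrix.PosSemidef.add ?_ (by split_ifs; exacts [hC, Matrix.PosSemidef.zero])
    have := (hA i).mul_mul_conjTranspose_same (s * s)
    rwa [Matrix.conjTranspose_mul, hs.isHermitian.eq] at this
  · rw [Finset.sum_add_distrib, ← Finset.sum_mul, ← Finset.mul_sum, ← hSdef, ← hRR]
    have : s * s * (r * r * (r * r)) * (s * s) = r * s := by
      calc _ = s * (s * r) * r * (r * (r * s) * s) := by simp only [Matrix.mul_assoc]
        _ = s * (r * s) * r * (r * (s * r) * s) := by rw [hsr]
        _ = (s * r) * (s * r) * ((r * s) * (r * s)) := by simp only [Matrix.mul_assoc]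
        _ = r * s := by rw [hsr, hEE, hEE]
    rw [this]
    simp
  · rw [Matrix.add_mul, Matrix.trace_add, Complex.add_re]
    have h1 := pgm_term_bound (hA i).isHermitian (hL i) (hLL i) hr.isHermitian hs.isHermitian
      (hEA i)
    rw [hRR] at h1
    have h2 : 0 ≤ ((if i = i₀ then 1 - r * s else 0) * A i).trace.re := by
      split_ifs
      · exact trace_mul_re_nonneg hC (hA i)
      · simp
    linarith

end Measurements

/-! ### Polar decomposition and Uhlmann's theorem. -/

section Fidelity

variable {n m : Type*} [Fintype n] [DecidableEq n] [Fintype m] [DecidableEq m]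

/-- Polar decomposition: `√(KK†) = K U` for a contraction `U`. -/
theorem exists_msqrt_eq_mul_contraction (K : Matrix n m ℂ) :
    ∃ U : Matrix m n ℂ, msqrt (K * Kᴴ) = K * U ∧ (1 - U * Uᴴ).PosSemidef := by
  obtain ⟨T, hT, hTS, hSTS, hTST⟩ := exists_sqrt_pseudoInverse (K * Kᴴ)
  have hR := (posSemidef_msqrt (K * Kᴴ)).isHermitian
  have hRR := msqrt_mul_self (Matrix.posSemidef_self_mul_conjTranspose K)
  set r := msqrt (K * Kᴴ)
  have hE : (r * T).IsHermitian := by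
    rw [Matrix.IsHermitian, Matrix.conjTranspose_mul, hT.isHermitian.eq, hR.eq, hTS]
  have hEE : r * T * (r * T) = r * T := by
    rw [Matrix.mul_assoc, ← Matrix.mul_assoc T r T, hTST]
  refine ⟨Kᴴ * T, ?_, ?_⟩
  · rw [← Matrix.mul_assoc, ← hRR, Matrix.mul_assoc, ← hTS, ← Matrix.mul_assoc, hSTS]
  · have h := posSemidef_sub_mul_conjTranspose (R := Kᴴ * T) (c := 1) one_pos (by
      have h1 : (Kᴴ * T)ᴴ * (Kᴴ * T) = r * T := by
        rw [Matrix.conjTranspose_mul, Matrix.conjTranspose_conjTranspose, hT.isHermitian.eq]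
        calc T * K * (Kᴴ * T) = T * (K * Kᴴ) * T := by simp only [Matrix.mul_assoc]
          _ = T * r * (r * T) := by rw [← hRR]; simp only [Matrix.mul_assoc]
          _ = _ := by rw [hTS, hEE]
      rw [h1, Complex.ofReal_one, one_smul]
      exact posSemidef_one_sub_projection hE hEE)
    rwa [Complex.ofReal_one, one_smul] at h

omit [DecidableEq m] in
/-- Uhlmann's theorem, with a subnormalized purification on a system of fixed size. -/
theorem exists_subPurification (W : Matrix n m ℂ) {τ : Matrix n n ℂ} (hτ : τ.PosSemidef) :
    ∃ V : Matrix n m ℂ, (τ - V * Vᴴ).PosSemidef ∧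
      (Wᴴ * V).trace.re = fidelity (W * Wᴴ) τ := by
  have ht := (posSemidef_msqrt τ).isHermitian
  have htt := msqrt_mul_self hτ
  have hW := Matrix.posSemidef_self_mul_conjTranspose W
  have hss := msqrt_mul_self hW
  have hs := (posSemidef_msqrt (W * Wᴴ)).isHermitian
  rw [fidelity, traceNorm]
  set t := msqrt τ
  set s := msqrt (W * Wᴴ)
  set Y := Wᴴ * t with hY
  have hYY : (s * t)ᴴ * (s * t) = Yᴴ * Y := by
    rw [hY, Matrix.conjTranspose_mul, Matrix.conjTranspose_mul, ht.eq, hs.eq,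
      Matrix.conjTranspose_conjTranspose]
    calc t * s * (s * t) = t * (s * s) * t := by simp only [Matrix.mul_assoc]
      _ = _ := by rw [hss]; simp only [Matrix.mul_assoc]
  rw [hYY]
  obtain ⟨T, hT, hTS, hSTS, hTST⟩ := exists_sqrt_pseudoInverse (Yᴴ * Y)
  have hR := (posSemidef_msqrt (Yᴴ * Y)).isHermitian
  have hRR := msqrt_mul_self (Matrix.posSemidef_conjTranspose_mul_self Y)
  set r := msqrt (Yᴴ * Y)
  have hE : (r * T).IsHermitian := by
    rw [Matrix.IsHermitian, Matrix.conjTranspose_mul, hT.isHermitian.eq, hR.eq, hTS]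
  have hEE : r * T * (r * T) = r * T := by
    rw [Matrix.mul_assoc, ← Matrix.mul_assoc T r T, hTST]
  -- With T the pseudo-inverse of |Y|, YT is the polar partial isometry of Y = W†√τ. It is not
  -- extended to an isometry, so VV† ≤ τ may be strict, while tr W†V = tr |Y| is still the full
  -- fidelity.
  refine ⟨t * (Y * T)ᴴ, ?_, ?_⟩
  · have h1 : τ - t * (Y * T)ᴴ * (t * (Y * T)ᴴ)ᴴ = t * (1 - r * T) * tᴴ := by
      rw [Matrix.conjTranspose_mul t, Matrix.conjTranspose_conjTranspose, Matrix.conjTranspose_mul,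
        hT.isHermitian.eq, ht.eq, Matrix.mul_sub, Matrix.sub_mul, Matrix.mul_one, htt]
      congr 1
      calc _ = t * (T * (Yᴴ * Y) * T) * t := by simp only [Matrix.mul_assoc]
        _ = t * ((T * r) * (r * T)) * t := by rw [← hRR]; simp only [Matrix.mul_assoc]
        _ = _ := by rw [hTS, hEE]
    rw [h1]
    exact (posSemidef_one_sub_projection hE hEE).mul_mul_conjTranspose_same t
  · congr 1
    rw [← Matrix.mul_assoc, ← hY, Matrix.conjTranspose_mul, hT.isHermitian.eq,
      Matrix.trace_mul_comm, Matrix.mul_assoc, ← hRR, ← Matrix.mul_assoc, hTS, hSTS]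

end Fidelity

/-! ### Measure-and-prepare channels. -/

section MeasurePrepare

theorem applyFst_apply {A B R : Type*} (T : Matrix A A ℂ →ₗ[ℂ] Matrix B B ℂ)
    (X : Matrix (A × R) (A × R) ℂ) (x y : B × R) :
    applyFst R T X x y =
      T (X.submatrix (fun a => (a, x.2)) (fun a => (a, y.2))) x.1 y.1 := rfl

variable {A B K : Type*} [Fintype A] [DecidableEq A] [Fintype B] [DecidableEq B] [Fintype K]

/-- Measure with the operators `Q k`, and prepare the basis state `g k` on outcome `k`. -/
noncomputable def measurePrepare (Q : K → Matrix A A ℂ) (g : K → B) :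
    Matrix A A ℂ →ₗ[ℂ] Matrix B B ℂ where
  toFun X := ∑ k, (Q k * X).trace • Matrix.single (g k) (g k) (1 : ℂ)
  map_add' X Y := by
    simp only [Matrix.mul_add, Matrix.trace_add, add_smul, Finset.sum_add_distrib]
  map_smul' c X := by
    simp only [Matrix.mul_smul, Matrix.trace_smul, smul_assoc, Finset.smul_sum, RingHom.id_apply]

omit [DecidableEq A] [Fintype B] in
theorem measurePrepare_apply (Q : K → Matrix A A ℂ) (g : K → B) (X : Matrix A A ℂ) :
    measurePrepare Q g X = ∑ k, (Q k * X).trace • Matrix.single (g k) (g k) (1 : ℂ) := rfl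

theorem isChannel_measurePrepare {Q : K → Matrix A A ℂ} (hQ : ∀ k, (Q k).PosSemidef)
    (hQ1 : ∑ k, Q k = 1) (g : K → B) : IsChannel (measurePrepare Q g) where
  completelyPositive l X hX := by
    -- Kraus operators |g k⟩⟨a| √Q_k ⊗ 1.
    let V : K → A → Matrix (B × Fin l) (A × Fin l) ℂ := fun k a =>
      Matrix.of fun x y => if x.1 = g k ∧ x.2 = y.2 then msqrt (Q k) a y.1 else 0
    have hV : ∀ k a x y, V k a x y = if x.1 = g k ∧ x.2 = y.2 then msqrt (Q k) a y.1 else 0 :=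
      fun _ _ _ _ => rfl
    have h : applyFst (Fin l) (measurePrepare Q g) X = ∑ k, ∑ a, V k a * X * (V k a)ᴴ := by
      ext x y
      rw [applyFst_apply, measurePrepare_apply]
      simp only [Matrix.sum_apply, Matrix.smul_apply, Matrix.single_apply, smul_eq_mul]
      refine Finset.sum_congr rfl fun k _ => ?_
      have hC := (posSemidef_msqrt (Q k)).isHermitian
      conv_lhs => rw [← msqrt_mul_self (hQ k), Matrix.mul_assoc, Matrix.trace_mul_comm]
      set C := msqrt (Q k) with hCdef
      by_cases hx : x.1 = g k
      · by_cases hy : y.1 = g k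
        · have h1 : ∀ a, (V k a * X * (V k a)ᴴ) x y =
              (C * X.submatrix (fun a => (a, x.2)) (fun a => (a, y.2)) * C) a a := by
            intro a
            simp only [Matrix.mul_apply, Matrix.conjTranspose_apply, hV, hx, hy, true_and,
              Matrix.submatrix_apply, Fintype.sum_prod_type, ← hCdef]
            simp only [ite_mul, zero_mul, Finset.sum_ite_eq, Finset.mem_univ, if_true, apply_ite,
              star_zero, mul_zero]
            refine Finset.sum_congr rfl fun a' _ => ?_
            rw [← hC.apply a a']
            simp
          simp only [h1, hx, hy, and_self, if_true, mul_one, Matrix.trace, Matrix.diag]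
        · have h1 : ∀ a, (V k a * X * (V k a)ᴴ) x y = 0 := by
            intro a
            simp [Matrix.mul_apply, hV, hy]
          simp [h1, Ne.symm hy]
      · have h1 : ∀ a, (V k a * X * (V k a)ᴴ) x y = 0 := by
          intro a
          simp [Matrix.mul_apply, hV, hx]
        simp [h1, Ne.symm hx]
    rw [h]
    exact Matrix.posSemidef_sum _ fun k _ => Matrix.posSemidef_sum _ fun a _ =>
      hX.mul_mul_conjTranspose_same _
  tracePreserving X := by
    simp only [measurePrepare_apply, Matrix.trace_sum, Matrix.trace_smul, Matrix.trace_single_eq_same,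
      smul_eq_mul, mul_one]
    rw [← Matrix.trace_sum, ← Finset.sum_mul, hQ1, Matrix.one_mul]

end MeasurePrepare

/-! ### The error probability as an average over messages. -/

section ErrorProbability

theorem traceNorm_diagonal {n : Type*} [Fintype n] [DecidableEq n] (d : n → ℝ) :
    traceNorm (Matrix.diagonal fun x => (d x : ℂ)) = ∑ x, |d x| := by
  have h1 : (Matrix.diagonal fun x => (d x : ℂ))ᴴ * (Matrix.diagonal fun x => (d x : ℂ)) =
      (Matrix.diagonal fun x => ((|d x| : ℝ) : ℂ)) * (Matrix.diagonal fun x => ((|d x| : ℝ) : ℂ)) := by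
    rw [Matrix.diagonal_conjTranspose, Matrix.diagonal_mul_diagonal, Matrix.diagonal_mul_diagonal]
    congr 1
    ext x
    simp only [Pi.star_apply, RCLike.star_def, Complex.conj_ofReal, ← Complex.ofReal_mul,
      abs_mul_abs_self]
  rw [traceNorm, h1, msqrt_mul_self_eq (Matrix.PosSemidef.diagonal fun x =>
    Complex.zero_le_real.2 (abs_nonneg (d x))), Matrix.trace_diagonal, Complex.re_sum]
  simp

theorem trace_mul_eq_ofReal_re {n : Type*} [Fintype n] {X Y : Matrix n n ℂ} (hX : X.IsHermitian)
    (hY : Y.IsHermitian) : (X * Y).trace = (((X * Y).trace.re : ℝ) : ℂ) := by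
  have h : star (X * Y).trace = (X * Y).trace := by
    rw [← Matrix.trace_conjTranspose, Matrix.conjTranspose_mul, hX.eq, hY.eq, Matrix.trace_mul_comm]
  exact (Complex.conj_eq_iff_re.1 h).symm

variable {A B M : Type*} [Fintype A] [DecidableEq A] [Fintype B] [DecidableEq B] [Fintype M]
  [DecidableEq M]

/-- The state prepared by a channel on a basis state of its input. -/
noncomputable def outputState (T : Matrix A A ℂ →ₗ[ℂ] Matrix B B ℂ) (a : A) : Matrix B B ℂ :=
  T (Matrix.single a a 1)

omit [DecidableEq B] in
theorem isState_outputState {T : Matrix A A ℂ →ₗ[ℂ] Matrix B B ℂ} (hT : IsChannel T) (a : A) :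
    IsState (outputState T a) := by
  constructor
  · have h1 : (Matrix.diagonal fun x : A × Fin 1 => if x.1 = a then (1 : ℂ) else 0).PosSemidef :=
      Matrix.PosSemidef.diagonal fun x => by
        simp only [Pi.zero_apply]; split_ifs <;> simp
    have h2 := (hT.completelyPositive 1 _ h1).submatrix (fun b : B => (b, 0))
    have h3 : Matrix.single a a (1 : ℂ) = (fun c c' =>
        (Matrix.diagonal fun x : A × Fin 1 => if x.1 = a then (1 : ℂ) else 0) (c, 0) (c', 0)) := by
      ext c c'
      simp only [Matrix.single_apply, Matrix.diagonal_apply, Prod.mk.injEq, and_true]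
      by_cases hc : c = a
      · subst hc; simp
      · simp [hc, Ne.symm hc]
    rw [outputState, h3]
    exact h2
  · rw [outputState, hT.tracePreserving, Matrix.trace_single_eq_same]

/-- Both states are diagonal, so the trace norm is an ℓ¹ distance. For message j the missing weight
p_j(1 - t_jj) on the correct outcome reappears on the wrong ones; counted twice, it cancels the
factor 1/2. -/
theorem errorProbability_eq {T : Matrix A A ℂ →ₗ[ℂ] Matrix B B ℂ} (hT : IsChannel T)
    {p : M → ℝ} (hp0 : ∀ m, 0 ≤ p m) (f : M → A) {Q : M → Matrix B B ℂ}
    (hQ : ∀ m, (Q m).PosSemidef) (hQ1 : ∑ m, Q m = 1) :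
    errorProbability p (measurePrepare (fun m : M => Matrix.single m m (1 : ℂ)) f) T
      (measurePrepare Q id) = ∑ m, p m * (1 - (Q m * outputState T (f m)).trace.re) := by
  have hρ := fun m => isState_outputState hT (f m)
  have hE : ∀ m : M, measurePrepare (fun m : M => Matrix.single m m (1 : ℂ)) f
      (Matrix.single m m 1) = Matrix.single (f m) (f m) 1 := by
    intro m
    rw [measurePrepare_apply, Finset.sum_eq_single m]
    · simp
    · intro b _ hb
      simp [Matrix.single_mul_single_of_ne, hb]
    · simp
  have hslice : ∀ r s : M, (correlatedState p).submatrix (fun a => (a, r)) (fun a => (a, s)) =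
      if r = s then (p r : ℂ) • Matrix.single r r 1 else 0 := by
    intro r s
    ext a a'
    by_cases hrs : r = s
    · subst hrs
      simp only [correlatedState, Matrix.submatrix_apply, Matrix.diagonal_apply, Prod.mk.injEq,
        and_true, if_true, Matrix.smul_apply, Matrix.single_apply, smul_eq_mul]
      by_cases h1 : a = r
      · subst h1; by_cases h2 : a = a' <;> simp [h2]
      · by_cases h2 : a = a' <;> simp [h1, Ne.symm h1]
    · simp [correlatedState, hrs]
  set t : M → M → ℝ := fun i j => (Q i * outputState T (f j)).trace.re with ht
  have ht0 : ∀ i j, 0 ≤ t i j := fun i j => trace_mul_re_nonneg (hQ i) (hρ j).1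
  have ht1 : ∀ j, ∑ i, t i j = 1 := by
    intro j
    rw [← Complex.re_sum, ← Matrix.trace_sum, ← Finset.sum_mul, hQ1, Matrix.one_mul, (hρ j).2,
      Complex.one_re]
  have hdiag : applyFst M (measurePrepare Q id ∘ₗ T ∘ₗ
      measurePrepare (fun m : M => Matrix.single m m (1 : ℂ)) f) (correlatedState p) -
      correlatedState p = Matrix.diagonal fun x : M × M =>
        ((p x.2 * t x.1 x.2 - if x.1 = x.2 then p x.2 else 0 : ℝ) : ℂ) := by
    ext ⟨i, r⟩ ⟨j, s⟩
    rw [Matrix.sub_apply, applyFst_apply]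
    simp only [hslice]
    by_cases hrs : r = s
    · subst hrs
      simp only [if_true, LinearMap.comp_apply, map_smul, hE]
      rw [measurePrepare_apply, Matrix.smul_apply, Matrix.sum_apply]
      simp only [Matrix.smul_apply, Matrix.single_apply, id]
      by_cases hij : i = j
      · subst hij
        have := trace_mul_eq_ofReal_re (hQ i).isHermitian (hρ r).1.isHermitian
        simp only [and_self, smul_eq_mul, mul_ite, mul_one, mul_zero, Finset.sum_ite_eq',
          Finset.mem_univ, if_true, Matrix.diagonal_apply_eq, ht, correlatedState]
        rw [outputState] at this
        rw [this]
        by_cases hir : i = r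
        · subst hir; simp [outputState]
        · simp [hir, outputState]
      · have : ∀ c, ¬ (c = i ∧ c = j) := fun c h => hij (h.1.symm.trans h.2)
        simp [this, correlatedState, hij]
    · simp [hrs, correlatedState]
  rw [errorProbability, hdiag, traceNorm_diagonal, Fintype.sum_prod_type_right, Finset.mul_sum]
  refine Finset.sum_congr rfl fun j _ => ?_
  have h1 : ∀ i, |p j * t i j - if i = j then p j else 0| =
      p j * t i j + if i = j then p j - 2 * (p j * t i j) else 0 := by
    intro i
    by_cases hij : i = j
    · subst hij
      have hle : t i i ≤ 1 := by
        rw [← ht1 i]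
        exact Finset.single_le_sum (f := fun k => t k i) (fun k _ => ht0 k i) (Finset.mem_univ i)
      have := mul_le_mul_of_nonneg_left hle (hp0 i)
      simp only [if_true]
      rw [abs_of_nonpos (by linarith)]
      ring
    · simp only [hij, if_false, sub_zero, add_zero]
      exact abs_of_nonneg (mul_nonneg (hp0 j) (ht0 i j))
  simp only [h1, Finset.sum_add_distrib, ← Finset.mul_sum, ht1]
  simp
  ring

end ErrorProbability

/-! ### Block-diagonal operators. -/

section FstBlock

variable {A B : Type*} [Fintype A] [DecidableEq A] [Fintype B] [DecidableEq B]

/-- The block diagonal operator `∑ a, |a⟩⟨a| ⊗ X a`. -/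
def fstBlock {A B : Type*} [DecidableEq A] (X : A → Matrix B B ℂ) : Matrix (A × B) (A × B) ℂ :=
  Matrix.of fun x y => if x.1 = y.1 then X x.1 x.2 y.2 else 0

omit [Fintype A] [Fintype B] [DecidableEq B] in
theorem fstBlock_apply (X : A → Matrix B B ℂ) (x y : A × B) :
    fstBlock X x y = if x.1 = y.1 then X x.1 x.2 y.2 else 0 := rfl

omit [DecidableEq B] in
theorem fstBlock_mul (X Y : A → Matrix B B ℂ) :
    fstBlock X * fstBlock Y = fstBlock fun a => X a * Y a := by
  ext ⟨a, b⟩ ⟨a', b'⟩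
  simp only [Matrix.mul_apply, fstBlock_apply, Fintype.sum_prod_type]
  rw [Finset.sum_eq_single a]
  · by_cases h : a = a' <;> simp [h]
  · intro c _ hc
    simp [Ne.symm hc]
  · simp

omit [Fintype A] [Fintype B] [DecidableEq B] in
theorem conjTranspose_fstBlock (X : A → Matrix B B ℂ) :
    (fstBlock X)ᴴ = fstBlock fun a => (X a)ᴴ := by
  ext ⟨a, b⟩ ⟨a', b'⟩
  simp only [Matrix.conjTranspose_apply, fstBlock_apply]
  by_cases h : a = a'
  · subst h; simp
  · simp [h, Ne.symm h]

theorem posSemidef_fstBlock {X : A → Matrix B B ℂ} (hX : ∀ a, (X a).PosSemidef) :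
    (fstBlock X).PosSemidef := by
  have h : fstBlock X = fstBlock (fun a => msqrt (X a)) * (fstBlock fun a => msqrt (X a))ᴴ := by
    rw [conjTranspose_fstBlock, fstBlock_mul]
    congr 1
    ext1 a
    rw [(posSemidef_msqrt (X a)).isHermitian.eq, msqrt_mul_self (hX a)]
  rw [h]
  exact Matrix.posSemidef_self_mul_conjTranspose _

theorem msqrt_smul {n : Type*} [Fintype n] [DecidableEq n] {X : Matrix n n ℂ} (hX : X.PosSemidef)
    {c : ℝ} (hc : 0 ≤ c) : msqrt ((c : ℂ) • X) = ((Real.sqrt c : ℝ) : ℂ) • msqrt X := by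
  have h : (c : ℂ) • X =
      (((Real.sqrt c : ℝ) : ℂ) • msqrt X) * (((Real.sqrt c : ℝ) : ℂ) • msqrt X) := by
    rw [Matrix.smul_mul, Matrix.mul_smul, smul_smul, msqrt_mul_self hX, ← Complex.ofReal_mul,
      Real.mul_self_sqrt hc]
  rw [h, msqrt_mul_self_eq]
  exact (posSemidef_msqrt X).smul (Complex.zero_le_real.2 (Real.sqrt_nonneg c))

theorem msqrt_fstBlock {X : A → Matrix B B ℂ} (hX : ∀ a, (X a).PosSemidef) :
    msqrt (fstBlock X) = fstBlock fun a => msqrt (X a) := by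
  have h : fstBlock X = fstBlock (fun a => msqrt (X a)) * fstBlock (fun a => msqrt (X a)) := by
    rw [fstBlock_mul]
    simp only [msqrt_mul_self (hX _)]
  rw [h, msqrt_mul_self_eq (posSemidef_fstBlock fun a => posSemidef_msqrt (X a))]

end FstBlock

/-! ### Amplitudes of the smoothed purification. -/

section Smoothing

variable {A B : Type*} [Fintype A] [DecidableEq A] [Fintype B] [DecidableEq B]

/-- The embedding of `AB` into `A(AB)` copying the first coordinate. -/
def copyFst (x : A × B) : A × (A × B) := (x.1, x)

/-- A purification of `ρ` on `ABC`, as an operator from `B` to `AC`. -/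
noncomputable def purificationOp (ρ : Matrix (A × B) (A × B) ℂ) : Matrix (A × (A × B)) B ℂ :=
  Matrix.of fun x b => purification ρ ((x.1, b), x.2)

theorem marginalAC_purification (ρ : Matrix (A × B) (A × B) ℂ) :
    marginalAC (purification ρ) = purificationOp ρ * (purificationOp ρ)ᴴ := by
  ext x y
  rfl

/-- For a classical-quantum state the purifying system repeats the classical label, so the
purification lives on the image of `copyFst`. The smoothed state need not be classical; only its
compression to this subspace matters. -/
theorem purificationOp_fstBlock {X : A → Matrix B B ℂ} (hX : ∀ a, (X a).PosSemidef)
    (x : A × (A × B)) (b : B) :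
    purificationOp (fstBlock X) x b = if x.1 = x.2.1 then msqrt (X x.1) b x.2.2 else 0 := by
  rw [purificationOp, Matrix.of_apply, purification, msqrt_fstBlock hX, fstBlock_apply]

/-- Normalization of ρ removes the correction term, leaving F² ≥ 1 - ε²; then F ≥ F² if F ≤ 1, and
otherwise the bound is trivial. -/
theorem one_sub_sq_le_of_purifiedDistance_le {n : Type*} [Fintype n] [DecidableEq n]
    {ρ τ : Matrix n n ℂ} (hρ : ρ.trace.re = 1) {ε : ℝ} (h : purifiedDistance ρ τ ≤ ε) :
    1 - ε ^ 2 ≤ fidelity ρ τ := by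
  have hF : 0 ≤ fidelity ρ τ := trace_re_nonneg (posSemidef_msqrt _)
  have h0 : 0 ≤ ε := (Real.sqrt_nonneg _).trans h
  rw [purifiedDistance, genFidelity, hρ, sub_self, zero_mul, Real.sqrt_zero, add_zero,
    Real.sqrt_le_left h0] at h
  nlinarith

/-- Amplitudes read off from an operator supported on the copied coordinate. -/
def amplitude (V : Matrix (A × (A × B)) B ℂ) (a : A) : Matrix B B ℂ :=
  Matrix.of fun b b' => V (copyFst (a, b')) b

/-- If the Gram operator of the amplitudes is dominated by `c 1 ⊗ σ`, the amplitudes have small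
overlap with every fixed operator. -/
theorem sum_trace_amplitude_le {V : Matrix (A × (A × B)) B ℂ} {σ : Matrix (A × B) (A × B) ℂ}
    (hσ : IsState σ) {c : ℝ} (hc : 0 < c)
    (h : ((c : ℂ) • ((1 : Matrix A A ℂ) ⊗ₖ σ) - V * Vᴴ).PosSemidef)
    {U : A → Matrix B B ℂ} (hU : ∀ a, (1 - U a * (U a)ᴴ).PosSemidef)
    {Q : Matrix B B ℂ} (hQ : (Qᴴ * Q).trace.re ≤ 1) :
    ∑ a, (amplitude V a * U a * Q).trace.re ≤ Real.sqrt c := by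
  set N : Matrix (A × B) B ℂ := V.submatrix copyFst id with hN
  -- Compressing 1 ⊗ σ along `copyFst` pinches σ to its diagonal blocks, whose traces sum to 1.
  set S : Matrix (A × B) (A × B) ℂ := fstBlock fun a => σ.submatrix (Prod.mk a) (Prod.mk a) with hS
  have hSpos : S.PosSemidef := posSemidef_fstBlock fun a => hσ.1.submatrix _
  have hNS : ((c : ℂ) • S - N * Nᴴ).PosSemidef := by
    have h1 := h.submatrix (copyFst : A × B → A × (A × B))
    convert h1 using 1
    ext ⟨a, b⟩ ⟨a', b'⟩
    simp only [Matrix.sub_apply, Matrix.smul_apply, Matrix.submatrix_apply, hS, fstBlock_apply,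
      Matrix.kroneckerMap_apply, copyFst, Matrix.mul_apply, hN, Matrix.conjTranspose_apply, id,
      Matrix.one_apply]
    by_cases haa : a = a'
    · subst haa; simp
    · simp [haa]
  obtain ⟨R, hR, hRR⟩ := exists_factor_of_le hSpos hc hNS
  have hr := (posSemidef_msqrt S).isHermitian
  have hrr := msqrt_mul_self hSpos
  set r := msqrt S
  set G : Matrix B (A × B) ℂ := Matrix.of fun b x => U x.1 x.2 b with hG
  have hGN : G * N = ∑ a, (U a)ᵀ * (amplitude V a)ᵀ := by
    ext b b'
    simp [Matrix.mul_apply, Matrix.sum_apply, Fintype.sum_prod_type, hG, hN, amplitude]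
  -- With N = √S R the sum is one Hilbert-Schmidt product: ‖RQᵀ‖² ≤ c because R†R ≤ c, and ‖G√S‖² ≤
  -- tr S = 1 because the U_a are contractions.
  have hsum : ∑ a, (amplitude V a * U a * Q).trace = ((R * Qᵀ) * (G * r)).trace := by
    calc ∑ a, (amplitude V a * U a * Q).trace = (Qᵀ * (G * N)).trace := by
          rw [hGN, Finset.mul_sum, Matrix.trace_sum]
          refine Finset.sum_congr rfl fun a _ => ?_
          rw [← Matrix.trace_transpose, Matrix.transpose_mul, Matrix.transpose_mul]
      _ = _ := by
          rw [hR, Matrix.trace_mul_comm (R * Qᵀ), Matrix.trace_mul_comm Qᵀ]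
          simp only [Matrix.mul_assoc]
  have hCS := trace_re_le_sqrt_mul_sqrt ((R * Qᵀ)ᴴ) (G * r)
  rw [Matrix.conjTranspose_conjTranspose] at hCS
  have h1 : (R * Qᵀ * (R * Qᵀ)ᴴ).trace.re ≤ c := by
    have h2 := trace_re_nonneg (hRR.conjTranspose_mul_mul_same Qᵀ)
    have h3 : ((Qᵀ)ᴴ * ((c : ℂ) • (1 : Matrix B B ℂ) - Rᴴ * R) * Qᵀ).trace =
        (c : ℂ) * (Qᴴ * Q).trace - (R * Qᵀ * (R * Qᵀ)ᴴ).trace := by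
      rw [Matrix.mul_sub, Matrix.sub_mul, Matrix.trace_sub, Matrix.trace_mul_comm (R * Qᵀ),
        Matrix.conjTranspose_mul]
      simp only [Matrix.mul_smul, Matrix.smul_mul, Matrix.mul_one, Matrix.trace_smul, smul_eq_mul,
        Matrix.mul_assoc]
      congr 2
      rw [← Matrix.trace_transpose, Matrix.transpose_mul, Matrix.transpose_transpose,
        Matrix.trace_mul_comm]
      rfl
    rw [h3, Complex.sub_re, Complex.re_ofReal_mul] at h2
    nlinarith
  have h2 : ((G * r)ᴴ * (G * r)).trace.re ≤ 1 := by
    have h3 : ((G * r)ᴴ * (G * r)).trace =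
        ∑ a, ((U a)ᵀᴴ * (U a)ᵀ * σ.submatrix (Prod.mk a) (Prod.mk a)).trace := by
      have h4 : G * S * Gᴴ =
          ∑ a, (U a)ᵀ * σ.submatrix (Prod.mk a) (Prod.mk a) * (U a)ᵀᴴ := by
        ext b b'
        simp only [Matrix.mul_apply, Matrix.sum_apply, Fintype.sum_prod_type, hG, hS,
          fstBlock_apply, Matrix.of_apply, Matrix.conjTranspose_apply, Matrix.transpose_apply,
          Matrix.submatrix_apply]
        refine Finset.sum_congr rfl fun a _ => Finset.sum_congr rfl fun x _ => ?_
        congr 1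
        rw [Finset.sum_eq_single a]
        · simp
        · intro a' _ ha'; simp [ha']
        · simp
      calc _ = (G * S * Gᴴ).trace := by
            rw [Matrix.trace_mul_comm, Matrix.conjTranspose_mul, hr.eq, ← hrr]
            simp only [Matrix.mul_assoc]
        _ = _ := by
            rw [h4, Matrix.trace_sum]
            refine Finset.sum_congr rfl fun a _ => ?_
            rw [Matrix.trace_mul_comm, Matrix.mul_assoc]
    have h5 : ∑ a, (σ.submatrix (Prod.mk a) (Prod.mk a)).trace = 1 := by
      rw [← hσ.2]
      simp [Matrix.trace, Fintype.sum_prod_type]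
    have h6 : ∑ a, (σ.submatrix (Prod.mk a) (Prod.mk a)).trace.re = 1 := by
      rw [← Complex.re_sum, h5, Complex.one_re]
    rw [h3, Complex.re_sum, ← h6]
    refine Finset.sum_le_sum fun a _ => ?_
    have h7 : (1 - (U a)ᵀᴴ * (U a)ᵀ).PosSemidef := by
      have := (hU a).transpose
      rw [Matrix.transpose_sub, Matrix.transpose_one, Matrix.transpose_mul] at this
      exact this
    have h8 := trace_mul_re_nonneg h7 (hσ.1.submatrix (Prod.mk a))
    rw [Matrix.sub_mul, Matrix.one_mul, Matrix.trace_sub, Complex.sub_re] at h8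
    linarith
  rw [← Complex.re_sum, hsum]
  refine hCS.trans ?_
  calc _ ≤ Real.sqrt c * Real.sqrt 1 :=
        mul_le_mul (Real.sqrt_le_sqrt (by simpa using h1)) (Real.sqrt_le_sqrt h2)
          (Real.sqrt_nonneg _) (Real.sqrt_nonneg _)
    _ = _ := by simp

omit [DecidableEq A] [DecidableEq B] in
-- The amplitudes keep only the entries of V on the copied coordinate, so the Hilbert-Schmidt norm
-- can only drop.
theorem sum_trace_amplitude_conjTranspose_mul_self_le (V : Matrix (A × (A × B)) B ℂ) :
    ∑ a, ((amplitude V a)ᴴ * amplitude V a).trace.re ≤ (V * Vᴴ).trace.re := by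
  have h0 : ∀ x, 0 ≤ ((V * Vᴴ) x x).re := fun x =>
    (Complex.nonneg_iff.1 (Matrix.posSemidef_self_mul_conjTranspose V).diag_nonneg).1
  have h1 : ∀ a b, (((amplitude V a)ᴴ * amplitude V a) b b).re =
      ((V * Vᴴ) (copyFst (a, b)) (copyFst (a, b))).re := by
    intro a b
    simp only [Matrix.mul_apply, Matrix.conjTranspose_apply, amplitude, Matrix.of_apply, mul_comm]
  simp only [Matrix.trace, Matrix.diag, Complex.re_sum, h1, Fintype.sum_prod_type]
  refine Finset.sum_le_sum fun a _ => ?_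
  exact Finset.single_le_sum (f := fun a' => ∑ b, ((V * Vᴴ) (a, (a', b)) (a, (a', b))).re)
    (fun a' _ => Finset.sum_nonneg fun b _ => h0 _) (Finset.mem_univ a)

theorem trace_purificationOp_mul {X : A → Matrix B B ℂ} (hX : ∀ a, (X a).PosSemidef)
    (V : Matrix (A × (A × B)) B ℂ) :
    ((purificationOp (fstBlock X))ᴴ * V).trace =
      ∑ a, ((msqrt (X a))ᴴ * amplitude V a).trace := by
  simp only [Matrix.trace, Matrix.diag, Matrix.mul_apply, Matrix.conjTranspose_apply,
    purificationOp_fstBlock hX, amplitude, Matrix.of_apply, copyFst, Fintype.sum_prod_type]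
  rw [Finset.sum_comm]
  refine Finset.sum_congr rfl fun a _ => ?_
  rw [Finset.sum_comm (γ := B)]
  conv_rhs => rw [Finset.sum_comm]
  rw [Finset.sum_comm]
  refine Finset.sum_congr rfl fun b _ => ?_
  rw [Finset.sum_eq_single a]
  · simp
  · intro a' _ ha'
    simp [Ne.symm ha']
  · simp

/-- Smoothing a classical-quantum state: amplitudes `K a` near `√ρ_a` inherit the min-entropy bound
of the smoothed state. -/
theorem exists_smoothed_amplitude [Nonempty A] {ρ : A → Matrix B B ℂ} (hρ : ∀ a, IsState (ρ a))
    {ε l : ℝ} {τ : Matrix (A × (A × B)) (A × (A × B)) ℂ} (hτ : IsSubState τ)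
    (hd : purifiedDistance (marginalAC (purification
      (fstBlock fun a => (((Fintype.card A : ℝ)⁻¹ : ℝ) : ℂ) • ρ a))) τ ≤ ε)
    {σ : Matrix (A × B) (A × B) ℂ} (hσ : IsState σ)
    (hl : ((((2 : ℝ) ^ (-l) : ℝ) : ℂ) • ((1 : Matrix A A ℂ) ⊗ₖ σ) - τ).PosSemidef) :
    ∃ K : A → Matrix B B ℂ,
      ∑ a, ((K a)ᴴ * K a).trace.re ≤ Fintype.card A ∧
      (1 - ε ^ 2) * Fintype.card A ≤ ∑ a, ((msqrt (ρ a))ᴴ * K a).trace.re ∧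
      ∀ U : A → Matrix B B ℂ, (∀ a, (1 - U a * (U a)ᴴ).PosSemidef) →
        ∀ Q : Matrix B B ℂ, (Qᴴ * Q).trace.re ≤ 1 →
          ∑ a, (K a * U a * Q).trace.re ≤
            Real.sqrt (Fintype.card A) * Real.sqrt ((2 : ℝ) ^ (-l)) := by
  set d : ℝ := (Fintype.card A : ℝ) with hdef
  have hdpos : 0 < d := Nat.cast_pos.2 Fintype.card_pos
  have hX : ∀ a, (((d⁻¹ : ℝ) : ℂ) • ρ a).PosSemidef := fun a =>
    (hρ a).1.smul (Complex.zero_le_real.2 (inv_nonneg.2 hdpos.le))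
  have hXs : ∀ a, msqrt (((d⁻¹ : ℝ) : ℂ) • ρ a) = ((Real.sqrt d⁻¹ : ℝ) : ℂ) • msqrt (ρ a) :=
    fun a => msqrt_smul (hρ a).1 (inv_nonneg.2 hdpos.le)
  have hXH : ∀ a, (msqrt (((d⁻¹ : ℝ) : ℂ) • ρ a))ᴴ = msqrt (((d⁻¹ : ℝ) : ℂ) • ρ a) := fun a =>
    (posSemidef_msqrt _).isHermitian.eq
  set W := purificationOp (fstBlock fun a => ((d⁻¹ : ℝ) : ℂ) • ρ a) with hW
  have hWtr : (W * Wᴴ).trace.re = 1 := by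
    rw [Matrix.trace_mul_comm, hW, trace_purificationOp_mul hX]
    have h1 : ∀ a, amplitude (purificationOp (fstBlock fun a => ((d⁻¹ : ℝ) : ℂ) • ρ a)) a =
        msqrt (((d⁻¹ : ℝ) : ℂ) • ρ a) := by
      intro a
      ext b b'
      rw [amplitude, Matrix.of_apply, purificationOp_fstBlock hX]
      simp [copyFst]
    simp only [h1, hXH, msqrt_mul_self (hX _), Matrix.trace_smul, (hρ _).2]
    simp [hdef]
  rw [marginalAC_purification] at hd
  have hF := one_sub_sq_le_of_purifiedDistance_le hWtr hd
  obtain ⟨V, hV, hVF⟩ := exists_subPurification W hτ.1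
  rw [← hVF, hW, trace_purificationOp_mul hX, Complex.re_sum] at hF
  have hsd : Real.sqrt d * Real.sqrt d = d := Real.mul_self_sqrt hdpos.le
  have hVV : (V * Vᴴ).trace.re ≤ 1 := by
    have := trace_re_nonneg hV
    rw [Matrix.trace_sub, Complex.sub_re] at this
    linarith [hτ.2]
  -- The factor √d undoes √(ρ_a/d) = √ρ_a/√d.
  refine ⟨fun a => ((Real.sqrt d : ℝ) : ℂ) • amplitude V a, ?_, ?_, fun U hU Q hQ => ?_⟩
  · simp only [Matrix.conjTranspose_smul, Matrix.smul_mul, Matrix.mul_smul, smul_smul,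
      Matrix.trace_smul, smul_eq_mul, RCLike.star_def, Complex.conj_ofReal, ← Complex.ofReal_mul,
      hsd, Complex.re_ofReal_mul]
    rw [← Finset.mul_sum]
    have := (sum_trace_amplitude_conjTranspose_mul_self_le V).trans hVV
    nlinarith
  · have h1 : ∀ a, ((msqrt (ρ a))ᴴ * ((Real.sqrt d : ℝ) : ℂ) • amplitude V a).trace.re =
        d * ((msqrt (((d⁻¹ : ℝ) : ℂ) • ρ a))ᴴ * amplitude V a).trace.re := by
      intro a
      rw [hXs]
      simp only [Matrix.conjTranspose_smul, Matrix.smul_mul, Matrix.mul_smul,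
        Matrix.trace_smul, smul_eq_mul, RCLike.star_def, Complex.conj_ofReal,
        Complex.re_ofReal_mul]
      rw [Real.sqrt_inv, ← mul_assoc]
      congr 1
      rw [← div_eq_mul_inv, eq_comm, div_eq_iff (Real.sqrt_pos.2 hdpos).ne', hsd]
    simp only [h1]
    rw [← Finset.mul_sum]
    nlinarith
  · have h1 : ((((2 : ℝ) ^ (-l) : ℝ) : ℂ) • ((1 : Matrix A A ℂ) ⊗ₖ σ) - V * Vᴴ).PosSemidef := by
      have := hl.add hV
      rwa [sub_add_sub_cancel] at this
    have h2 := sum_trace_amplitude_le hσ (Real.rpow_pos_of_pos two_pos _) h1 hU hQ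
    simp only [Matrix.smul_mul, Matrix.trace_smul, smul_eq_mul, Complex.re_ofReal_mul]
    rw [← Finset.mul_sum]
    exact mul_le_mul_of_nonneg_left h2 (Real.sqrt_nonneg d)

end Smoothing

/-! ### Tests of each output state against the average. -/

section Tests

variable {A B : Type*} [Fintype A] [DecidableEq A] [Fintype B] [DecidableEq B]

/-- The left side is Re⟨R - K, P(R + K)⟩, since the cross terms cancel in the real part;
Cauchy-Schwarz finishes. -/
theorem trace_sub_mul_projection_re_le (R K : Matrix B B ℂ) {P : Matrix B B ℂ} (hP : P.IsHermitian)
    (hPP : P * P = P) :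
    (R * Rᴴ * P).trace.re - (K * Kᴴ * P).trace.re ≤
      Real.sqrt ((R - K)ᴴ * (R - K)).trace.re * Real.sqrt ((R + K)ᴴ * (R + K)).trace.re := by
  have h1 : ∀ X Y : Matrix B B ℂ, (X * Yᴴ * P).trace = (Yᴴ * (P * X)).trace := by
    intro X Y
    rw [Matrix.mul_assoc, Matrix.trace_mul_comm, Matrix.mul_assoc]
  have h2 : (Rᴴ * (P * K)).trace.re = (Kᴴ * (P * R)).trace.re := by
    rw [trace_conjTranspose_mul_re_comm, Matrix.conjTranspose_mul, hP.eq, Matrix.mul_assoc]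
  have h3 := trace_re_le_sqrt_mul_sqrt (R - K) (P * (R + K))
  have h4 : ((R - K)ᴴ * (P * (R + K))).trace.re =
      (R * Rᴴ * P).trace.re - (K * Kᴴ * P).trace.re := by
    rw [h1, h1]
    simp only [Matrix.conjTranspose_sub, Matrix.sub_mul, Matrix.mul_add, Matrix.trace_sub,
      Matrix.trace_add, Complex.sub_re, Complex.add_re, h2]
    ring
  have h5 : ((P * (R + K))ᴴ * (P * (R + K))).trace.re ≤ ((R + K)ᴴ * (R + K)).trace.re := by
    have h6 := trace_re_nonneg
      ((posSemidef_one_sub_projection hP hPP).conjTranspose_mul_mul_same (R + K))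
    have h7 : (P * (R + K))ᴴ * (P * (R + K)) = (R + K)ᴴ * P * (R + K) := by
      rw [Matrix.conjTranspose_mul, hP.eq, Matrix.mul_assoc, ← Matrix.mul_assoc P P, hPP,
        Matrix.mul_assoc]
    rw [Matrix.mul_sub, Matrix.sub_mul, Matrix.mul_one, Matrix.trace_sub, Complex.sub_re] at h6
    rw [h7]
    linarith
  rw [h4] at h3
  exact h3.trans (mul_le_mul_of_nonneg_left (Real.sqrt_le_sqrt h5) (Real.sqrt_nonneg _))

/-- The average of a family of states. -/
noncomputable def averageState (ρ : A → Matrix B B ℂ) : Matrix B B ℂ :=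
  (((Fintype.card A : ℝ)⁻¹ : ℝ) : ℂ) • ∑ a, ρ a

omit [DecidableEq A] [DecidableEq B] in
theorem isState_averageState [Nonempty A] {ρ : A → Matrix B B ℂ} (hρ : ∀ a, IsState (ρ a)) :
    IsState (averageState ρ) := by
  refine ⟨(Matrix.posSemidef_sum _ fun a _ => (hρ a).1).smul
    (Complex.zero_le_real.2 (by positivity)), ?_⟩
  simp [averageState, Matrix.trace_sum, (hρ _).2]

omit [DecidableEq A] in
/-- Projective tests distinguishing each state from the average, with small average error. -/
theorem exists_tests [Nonempty A] {ρ K : A → Matrix B B ℂ} (hρ : ∀ a, IsState (ρ a))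
    {ε g : ℝ} (hε : 0 ≤ ε)
    (hK1 : ∑ a, ((K a)ᴴ * K a).trace.re ≤ Fintype.card A)
    (hK2 : (1 - ε ^ 2) * Fintype.card A ≤ ∑ a, ((msqrt (ρ a))ᴴ * K a).trace.re)
    (hK3 : ∀ U : A → Matrix B B ℂ, (∀ a, (1 - U a * (U a)ᴴ).PosSemidef) →
        ∀ Q : Matrix B B ℂ, (Qᴴ * Q).trace.re ≤ 1 → ∑ a, (K a * U a * Q).trace.re ≤ g)
    {q : ℝ} (hq0 : 0 ≤ q) (hq1 : q ≤ 1) :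
    ∃ L : A → Matrix B B ℂ, (∀ a, (L a).IsHermitian) ∧ (∀ a, L a * L a = L a) ∧
      ∑ a, (q * (1 - (ρ a * L a).trace.re) + (1 - q) * (averageState ρ * L a).trace.re) ≤
        Real.sqrt q * g + q * (3 * ε * Fintype.card A) := by
  have hd : (0 : ℝ) < Fintype.card A := Nat.cast_pos.2 Fintype.card_pos
  have hav := isState_averageState hρ
  have hq1' : 0 ≤ 1 - q := by linarith
  have hKK : ∀ a, (K a * (K a)ᴴ).PosSemidef := fun a => Matrix.posSemidef_self_mul_conjTranspose _
  -- The tests are built for q K_a K_a† against (1 - q) ρ̄, because the entropy bound controls K_a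
  -- and not √ρ_a.
  choose L hL hLL hLe using fun a => exists_test
    ((hKK a).smul (Complex.zero_le_real.2 hq0)) (hav.1.smul (Complex.zero_le_real.2 hq1'))
  choose U hU hUU using fun a => exists_msqrt_eq_mul_contraction (K a)
  have hQ := posSemidef_msqrt (averageState ρ)
  have hsum := hK3 U hUU (msqrt (averageState ρ)) (by
    rw [hQ.isHermitian.eq, msqrt_mul_self hav.1, hav.2, Complex.one_re])
  refine ⟨L, hL, hLL, ?_⟩
  have h1 : ∀ a, q * (K a * (K a)ᴴ * (1 - L a)).trace.re +
      (1 - q) * (averageState ρ * L a).trace.re ≤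
      Real.sqrt q * (K a * U a * msqrt (averageState ρ)).trace.re := by
    intro a
    have h2 := hLe a
    rw [msqrt_smul (hKK a) hq0, msqrt_smul hav.1 hq1', hU] at h2
    simp only [Matrix.smul_mul, Matrix.mul_smul, Matrix.trace_smul, smul_eq_mul,
      Complex.re_ofReal_mul] at h2
    have h3 : 0 ≤ (K a * U a * msqrt (averageState ρ)).trace.re := by
      rw [← hU]
      exact trace_mul_re_nonneg (posSemidef_msqrt _) hQ
    have h4 : Real.sqrt (1 - q) ≤ 1 := Real.sqrt_le_one.2 (by linarith)
    have h5 := mul_le_mul_of_nonneg_right h4 (mul_nonneg (Real.sqrt_nonneg q) h3)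
    linarith
  set x : A → ℝ := fun a => ((msqrt (ρ a) - K a)ᴴ * (msqrt (ρ a) - K a)).trace.re with hx
  set y : A → ℝ := fun a => ((msqrt (ρ a) + K a)ᴴ * (msqrt (ρ a) + K a)).trace.re with hy
  have hρρ : ∀ a, ((msqrt (ρ a))ᴴ * msqrt (ρ a)).trace.re = 1 := fun a => by
    rw [(posSemidef_msqrt (ρ a)).isHermitian.eq, msqrt_mul_self (hρ a).1, (hρ a).2, Complex.one_re]
  have h6 : ∀ a, 1 - (ρ a * L a).trace.re ≤
      (K a * (K a)ᴴ * (1 - L a)).trace.re + Real.sqrt (x a) * Real.sqrt (y a) := by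
    intro a
    have h7 := trace_sub_mul_projection_re_le (msqrt (ρ a)) (K a)
      (P := 1 - L a) (Matrix.isHermitian_one.sub (hL a))
      (by rw [Matrix.sub_mul, Matrix.mul_sub, Matrix.mul_sub, hLL]; simp)
    have h8 : (msqrt (ρ a) * (msqrt (ρ a))ᴴ * (1 - L a)).trace.re = 1 - (ρ a * L a).trace.re := by
      rw [(posSemidef_msqrt (ρ a)).isHermitian.eq, msqrt_mul_self (hρ a).1, Matrix.mul_sub,
        Matrix.mul_one, Matrix.trace_sub, (hρ a).2, Complex.sub_re, Complex.one_re]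
    rw [h8] at h7
    linarith
  have hx0 : ∀ a, 0 ≤ x a := fun a => trace_conjTranspose_mul_self_re_nonneg _
  have hy0 : ∀ a, 0 ≤ y a := fun a => trace_conjTranspose_mul_self_re_nonneg _
  have hxs : ∑ a, x a ≤ 2 * ε ^ 2 * Fintype.card A := by
    simp only [hx, trace_conjTranspose_sub_mul_sub_re, hρρ, Finset.sum_add_distrib,
      Finset.sum_sub_distrib, ← Finset.mul_sum]
    simp
    linarith
  have hys : ∑ a, y a ≤ 4 * Fintype.card A := by
    have h9 : ∑ a, y a ≤ ∑ a, (2 + 2 * ((K a)ᴴ * K a).trace.re) := by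
      refine Finset.sum_le_sum fun a _ => ?_
      have := two_mul_trace_re_le (msqrt (ρ a)) (K a)
      simp only [hy, trace_conjTranspose_add_mul_add_re, hρρ] at this ⊢
      linarith
    refine h9.trans ?_
    rw [Finset.sum_add_distrib, ← Finset.mul_sum]
    simp
    linarith
  -- Cauchy-Schwarz gives √(2ε² · 4) = √8 ε times the cardinality; √8 is rounded up to 3.
  have hxy : ∑ a, Real.sqrt (x a) * Real.sqrt (y a) ≤ 3 * ε * Fintype.card A := by
    refine (Real.sum_sqrt_mul_sqrt_le _ hx0 hy0).trans ?_
    rw [← Real.sqrt_mul (Finset.sum_nonneg fun a _ => hx0 a)]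
    apply Real.sqrt_le_iff.2 ⟨by positivity, ?_⟩
    have h10 := mul_le_mul hxs hys (Finset.sum_nonneg fun a _ => hy0 a) (by positivity)
    nlinarith [sq_nonneg (ε * Fintype.card A)]
  calc _ ≤ ∑ a, (Real.sqrt q * (K a * U a * msqrt (averageState ρ)).trace.re +
        q * (Real.sqrt (x a) * Real.sqrt (y a))) := by
        refine Finset.sum_le_sum fun a _ => ?_
        have := mul_le_mul_of_nonneg_left (h6 a) hq0
        have := h1 a
        linarith
    _ ≤ _ := by
        rw [Finset.sum_add_distrib, ← Finset.mul_sum, ← Finset.mul_sum]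
        exact add_le_add (mul_le_mul_of_nonneg_left hsum (Real.sqrt_nonneg q))
          (mul_le_mul_of_nonneg_left hxy hq0)

end Tests

/-! ### Random codes and their derandomization. -/

section RandomCode

variable {M A : Type*} [Fintype M] [DecidableEq M] [Fintype A]

/-- Resampling one codeword preserves the uniform measure on codes: exchanging f i with a is an
involution of pairs (f, a). -/
theorem sum_sum_update (i : M) (G : (M → A) → ℝ) :
    ∑ f : M → A, ∑ a, G (Function.update f i a) = Fintype.card A * ∑ f, G f := by
  classical
  let e : (M → A) × A ≃ (M → A) × A :=
    { toFun := fun x => (Function.update x.1 i x.2, x.1 i)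
      invFun := fun x => (Function.update x.1 i x.2, x.1 i)
      left_inv := fun x => by simp
      right_inv := fun x => by simp }
  calc ∑ f : M → A, ∑ a, G (Function.update f i a) = ∑ x : (M → A) × A, G (e x).1 := by
        rw [Fintype.sum_prod_type]
        rfl
    _ = ∑ x : (M → A) × A, G x.1 := Equiv.sum_comp e fun x => G x.1
    _ = _ := by
        rw [Fintype.sum_prod_type]
        simp [Finset.mul_sum]

/-- Derandomization: some code does at least as well as independent uniform codewords. -/
theorem exists_code_le_average [Nonempty A] (α : M → A → ℝ) (β : M → M → A → A → ℝ) :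
    ∃ f : M → A, ∑ i, (α i (f i) + ∑ j ∈ Finset.univ.erase i, β i j (f i) (f j)) ≤
      ∑ i, ((Fintype.card A : ℝ)⁻¹ * ∑ a, (α i a +
        ∑ j ∈ Finset.univ.erase i, (Fintype.card A : ℝ)⁻¹ * ∑ a', β i j a a')) := by
  classical
  have hd : (Fintype.card A : ℝ) ≠ 0 := Nat.cast_ne_zero.2 Fintype.card_ne_zero
  have h1 : ∀ (i : M) (G : (M → A) → ℝ), ∑ f, G f =
      ∑ f : M → A, (Fintype.card A : ℝ)⁻¹ * ∑ a, G (Function.update f i a) := by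
    intro i G
    rw [← Finset.mul_sum, sum_sum_update, inv_mul_cancel_left₀ hd]
  have h2 : ∀ i, ∑ f : M → A, α i (f i) =
      ∑ _f : M → A, (Fintype.card A : ℝ)⁻¹ * ∑ a, α i a := by
    intro i
    rw [h1 i]
    simp
  have h3 : ∀ i j, j ∈ Finset.univ.erase i → ∑ f : M → A, β i j (f i) (f j) =
      ∑ _f : M → A, (Fintype.card A : ℝ)⁻¹ * ∑ a, (Fintype.card A : ℝ)⁻¹ * ∑ a', β i j a a' := by
    intro i j hj
    have hij : j ≠ i := Finset.ne_of_mem_erase hj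
    rw [h1 i]
    simp only [Function.update_self, Function.update_of_ne hij]
    rw [h1 j]
    simp only [Function.update_self]
    refine Finset.sum_congr rfl fun f _ => ?_
    simp only [Finset.mul_sum]
    exact Finset.sum_comm
  obtain ⟨f, -, hf⟩ := Finset.exists_le_of_sum_le (s := (Finset.univ : Finset (M → A)))
    Finset.univ_nonempty (f := fun f : M → A =>
      ∑ i, (α i (f i) + ∑ j ∈ Finset.univ.erase i, β i j (f i) (f j)))
    (g := fun _ => ∑ i, ((Fintype.card A : ℝ)⁻¹ * ∑ a, (α i a +
        ∑ j ∈ Finset.univ.erase i, (Fintype.card A : ℝ)⁻¹ * ∑ a', β i j a a')))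
    (le_of_eq (by
      rw [Finset.sum_comm]
      rw [Finset.sum_comm (s := (Finset.univ : Finset (M → A)))]
      refine Finset.sum_congr rfl fun i _ => ?_
      rw [Finset.sum_add_distrib, h2, Finset.sum_comm, Finset.sum_congr rfl (h3 i),
        Finset.sum_comm, ← Finset.sum_add_distrib]
      refine Finset.sum_congr rfl fun f _ => ?_
      rw [Finset.sum_add_distrib, mul_add]
      congr 1
      rw [Finset.sum_comm, Finset.mul_sum]))
  exact ⟨f, hf⟩

variable {B : Type*} [Fintype B] [DecidableEq B]

/-- One-shot coding: a code and a measurement with small average error. -/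
theorem exists_code [Nonempty A] {ρ K : A → Matrix B B ℂ} (hρ : ∀ a, IsState (ρ a))
    {ε g : ℝ} (hε : 0 ≤ ε)
    (hK1 : ∑ a, ((K a)ᴴ * K a).trace.re ≤ Fintype.card A)
    (hK2 : (1 - ε ^ 2) * Fintype.card A ≤ ∑ a, ((msqrt (ρ a))ᴴ * K a).trace.re)
    (hK3 : ∀ U : A → Matrix B B ℂ, (∀ a, (1 - U a * (U a)ᴴ).PosSemidef) →
        ∀ Q : Matrix B B ℂ, (Qᴴ * Q).trace.re ≤ 1 → ∑ a, (K a * U a * Q).trace.re ≤ g)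
    {p : M → ℝ} (hp0 : ∀ m, 0 ≤ p m) (hp1 : ∑ m, p m = 1) :
    ∃ (f : M → A) (Q : M → Matrix B B ℂ), (∀ m, (Q m).PosSemidef) ∧ ∑ m, Q m = 1 ∧
      ∑ m, p m * (1 - (Q m * ρ (f m)).trace.re) ≤
        (∑ m, Real.sqrt (p m)) * ((Fintype.card A : ℝ)⁻¹ * g) + 3 * ε := by
  have hd : (0 : ℝ) < Fintype.card A := Nat.cast_pos.2 Fintype.card_pos
  have hM : Nonempty M := by
    by_contra h
    rw [not_nonempty_iff] at h
    simp at hp1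
  have hple : ∀ m, p m ≤ 1 := fun m => by
    rw [← hp1]
    exact Finset.single_le_sum (fun k _ => hp0 k) (Finset.mem_univ m)
  -- The prior for message m is q = p m: the competing codewords have total weight 1 - p m and
  -- average to ρ̄.
  choose L hL hLL hLe using fun m => exists_tests hρ hε hK1 hK2 hK3 (hp0 m) (hple m)
  obtain ⟨f, hf⟩ := exists_code_le_average (fun i a => p i * (1 - (ρ a * L i a).trace.re))
    (fun i j a a' => p j * (ρ a' * L i a).trace.re)
  obtain ⟨Q, hQ, hQ1, hQe⟩ := exists_measurement
    (A := fun i => ((p i : ℝ) : ℂ) • ρ (f i)) (L := fun i => L i (f i))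
    (fun i => (hρ _).1.smul (Complex.zero_le_real.2 (hp0 i))) (fun i => hL i _) (fun i => hLL i _)
  refine ⟨f, Q, hQ, hQ1, ?_⟩
  have h1 : ∑ m, p m * (1 - (Q m * ρ (f m)).trace.re) ≤
      ∑ i, (p i * (1 - (ρ (f i) * L i (f i)).trace.re) +
        ∑ j ∈ Finset.univ.erase i, p j * (ρ (f j) * L i (f i)).trace.re) := by
    have h2 : ∀ i, ((∑ j, ((p j : ℝ) : ℂ) • ρ (f j)) * L i (f i)).trace.re =
        p i * (ρ (f i) * L i (f i)).trace.re +
          ∑ j ∈ Finset.univ.erase i, p j * (ρ (f j) * L i (f i)).trace.re := by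
      intro i
      rw [Finset.sum_mul, Matrix.trace_sum, Complex.re_sum,
        ← Finset.add_sum_erase _ _ (Finset.mem_univ i)]
      simp only [Matrix.smul_mul, Matrix.trace_smul, smul_eq_mul, Complex.re_ofReal_mul]
    simp only [h2, Matrix.smul_mul, Matrix.mul_smul, Matrix.trace_smul, smul_eq_mul,
      Complex.re_ofReal_mul] at hQe
    have h3 : ∑ m, p m * (1 - (Q m * ρ (f m)).trace.re) =
        ∑ m, p m - ∑ m, p m * (Q m * ρ (f m)).trace.re := by
      rw [← Finset.sum_sub_distrib]
      exact Finset.sum_congr rfl fun m _ => by ring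
    have h4 : ∑ i, (p i * (1 - (ρ (f i) * L i (f i)).trace.re) +
        ∑ j ∈ Finset.univ.erase i, p j * (ρ (f j) * L i (f i)).trace.re) =
        ∑ m, p m - ∑ i, (2 * (p i * (ρ (f i) * L i (f i)).trace.re) -
          (p i * (ρ (f i) * L i (f i)).trace.re +
          ∑ j ∈ Finset.univ.erase i, p j * (ρ (f j) * L i (f i)).trace.re)) := by
      rw [← Finset.sum_sub_distrib]
      exact Finset.sum_congr rfl fun m _ => by ring
    rw [h3, h4]
    exact sub_le_sub_left hQe _
  refine (h1.trans hf).trans ?_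
  have h5 : ∀ i a, ∑ j ∈ Finset.univ.erase i,
      (Fintype.card A : ℝ)⁻¹ * ∑ a', p j * (ρ a' * L i a).trace.re =
        (1 - p i) * (averageState ρ * L i a).trace.re := by
    intro i a
    have h6 : (averageState ρ * L i a).trace.re =
        (Fintype.card A : ℝ)⁻¹ * ∑ a', (ρ a' * L i a).trace.re := by
      rw [averageState, Matrix.smul_mul, Matrix.trace_smul, smul_eq_mul, Complex.re_ofReal_mul,
        Finset.sum_mul, Matrix.trace_sum, Complex.re_sum]
    rw [h6, ← hp1, ← Finset.add_sum_erase _ p (Finset.mem_univ i), add_sub_cancel_left,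
      Finset.sum_mul]
    refine Finset.sum_congr rfl fun j _ => ?_
    rw [← Finset.mul_sum]
    ring
  simp only [h5]
  calc _ ≤ ∑ i, (Fintype.card A : ℝ)⁻¹ *
        (Real.sqrt (p i) * g + p i * (3 * ε * Fintype.card A)) :=
        Finset.sum_le_sum fun i _ => mul_le_mul_of_nonneg_left (hLe i) (inv_nonneg.2 hd.le)
    _ = ∑ i, (Real.sqrt (p i) * ((Fintype.card A : ℝ)⁻¹ * g) + p i * (3 * ε)) := by
        refine Finset.sum_congr rfl fun i _ => ?_
        field_simp
    _ = _ := by rw [Finset.sum_add_distrib, ← Finset.sum_mul, ← Finset.sum_mul, hp1, one_mul]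

end RandomCode

/-! ### From entropies to real inequalities. -/

section Entropies

variable {A B M : Type*} [Fintype A] [DecidableEq A] [Fintype B] [DecidableEq B]
  [Fintype M] [DecidableEq M]

omit [Fintype B] [DecidableEq B] in
theorem choi_eq_fstBlock [Nonempty A] {T : Matrix A A ℂ →ₗ[ℂ] Matrix B B ℂ}
    (hT : IsClassicalOnFst (choi T)) :
    choi T = fstBlock fun a => (((Fintype.card A : ℝ)⁻¹ : ℝ) : ℂ) • outputState T a := by
  obtain ⟨σ, -, hσ⟩ := hT
  have hd : (Fintype.card A : ℂ) ≠ 0 := Nat.cast_ne_zero.2 Fintype.card_ne_zero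
  ext ⟨a, b⟩ ⟨a', b'⟩
  by_cases h : a = a'
  · subst h
    simp [choi, fstBlock_apply, outputState, Matrix.sum_apply, Matrix.single_apply, ite_and]
  · rw [hσ, fstBlock_apply, if_neg h, Matrix.sum_apply]
    refine Finset.sum_eq_zero fun i _ => ?_
    have : ¬ (i = a ∧ i = a') := fun hi => h (hi.1.symm.trans hi.2)
    simp [this]

omit [DecidableEq M] in
theorem sum_sqrt_pos {p : M → ℝ} (hp0 : ∀ m, 0 ≤ p m) (hp1 : ∑ m, p m = 1) :
    0 < ∑ m, Real.sqrt (p m) := by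
  refine (Finset.sum_nonneg fun m _ => Real.sqrt_nonneg _).lt_of_ne fun h => ?_
  rw [eq_comm, Finset.sum_eq_zero_iff_of_nonneg fun m _ => Real.sqrt_nonneg _] at h
  have : ∑ m, p m = 0 := Finset.sum_eq_zero fun m hm => (Real.sqrt_eq_zero (hp0 m)).1 (h m hm)
  linarith

/-- Evaluating the operator inequality on the vector ∑ |m⟩|m⟩ gives (∑ √p_m)² ≤ 2^{-l} tr σ. Only
this half of H_max(M) = 2 log ∑ √p_m is needed. -/
theorem le_maxEntropyOfDistribution {p : M → ℝ} (hp0 : ∀ m, 0 ≤ p m) (hp1 : ∑ m, p m = 1) :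
    ((2 * Real.logb 2 (∑ m, Real.sqrt (p m)) : ℝ) : EReal) ≤ maxEntropyOfDistribution p := by
  have hs := sum_sqrt_pos hp0 hp1
  rw [maxEntropyOfDistribution, maxEntropy, EReal.le_neg, ← EReal.coe_neg]
  refine iSup₂_le fun σ hσ => iSup₂_le fun l hl => EReal.coe_le_coe_iff.2 ?_
  have hsq : msqrt (Matrix.diagonal fun x : M × Unit => ((p x.1 : ℝ) : ℂ)) =
      Matrix.diagonal fun x : M × Unit => ((Real.sqrt (p x.1) : ℝ) : ℂ) := by
    have h1 : (Matrix.diagonal fun x : M × Unit => ((p x.1 : ℝ) : ℂ)) =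
        (Matrix.diagonal fun x : M × Unit => ((Real.sqrt (p x.1) : ℝ) : ℂ)) *
          Matrix.diagonal fun x : M × Unit => ((Real.sqrt (p x.1) : ℝ) : ℂ) := by
      rw [Matrix.diagonal_mul_diagonal]
      congr 1
      ext x
      rw [← Complex.ofReal_mul, Real.mul_self_sqrt (hp0 _)]
    rw [h1, msqrt_mul_self_eq]
    exact Matrix.PosSemidef.diagonal fun x => Complex.zero_le_real.2 (Real.sqrt_nonneg _)
  let e : M → M × (M × Unit) := fun m => (m, (m, ()))
  have h2 := (hl.submatrix e).dotProduct_mulVec_nonneg (fun _ => 1)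
  have h3 : ∀ m m', ((((2 : ℝ) ^ (-l) : ℝ) : ℂ) • ((1 : Matrix M M ℂ) ⊗ₖ σ) -
      marginalAC (purification (Matrix.diagonal fun x : M × Unit => ((p x.1 : ℝ) : ℂ)))).submatrix
        e e m m' = (if m = m' then (((2 : ℝ) ^ (-l) : ℝ) : ℂ) * σ (m, ()) (m, ()) else 0) -
          ((Real.sqrt (p m) : ℝ) : ℂ) * ((Real.sqrt (p m') : ℝ) : ℂ) := by
    intro m m'
    have h4 : marginalAC (purification (Matrix.diagonal fun x : M × Unit => ((p x.1 : ℝ) : ℂ)))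
        (e m) (e m') = ((Real.sqrt (p m) : ℝ) : ℂ) * ((Real.sqrt (p m') : ℝ) : ℂ) := by
      simp [marginalAC, purification, hsq, e]
    rw [Matrix.submatrix_apply, Matrix.sub_apply, h4]
    congr 1
    by_cases hm : m = m'
    · subst hm; simp [e]
    · simp [e, hm]
  have h5 : (star (fun _ : M => (1 : ℂ)) ⬝ᵥ
      ((((2 : ℝ) ^ (-l) : ℝ) : ℂ) • ((1 : Matrix M M ℂ) ⊗ₖ σ) -
      marginalAC (purification (Matrix.diagonal fun x : M × Unit => ((p x.1 : ℝ) : ℂ)))).submatrix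
        e e *ᵥ fun _ => 1) =
      (((2 : ℝ) ^ (-l) - (∑ m, Real.sqrt (p m)) ^ 2 : ℝ) : ℂ) := by
    have h6 : ∑ m, σ (m, ()) (m, ()) = 1 := by
      rw [← hσ.2]
      simp [Matrix.trace, Fintype.sum_prod_type]
    simp only [dotProduct, Matrix.mulVec, h3, Pi.star_apply, star_one, one_mul, mul_one,
      Finset.sum_sub_distrib, Finset.sum_ite_eq, Finset.mem_univ, if_true]
    rw [← Finset.mul_sum, h6, ← Finset.sum_mul_sum]
    push_cast
    ring
  rw [h5] at h2
  have h7 : (∑ m, Real.sqrt (p m)) ^ 2 ≤ (2 : ℝ) ^ (-l) := sub_nonneg.1 (Complex.zero_le_real.1 h2)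
  have h8 := (Real.logb_le_iff_le_rpow one_lt_two (by positivity)).2 h7
  rw [Real.logb_pow] at h8
  push_cast at h8
  linarith

end Entropies

/-- The entropic hypothesis of the coding theorem, in real numbers, as a strict lower bound on the
smooth min-entropy `S`. -/
theorem lt_smoothMinEntropy {s d x : ℝ} {H S : EReal} (hd : 0 < d)
    (hH : ((2 * Real.logb 2 s : ℝ) : EReal) ≤ H)
    (h : H ≤ log2 d - -S - 1 + 2 * log2 x) :
    0 < x ∧ ((2 * Real.logb 2 s - Real.logb 2 d - 2 * Real.logb 2 x : ℝ) : EReal) < S := by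
  replace h := hH.trans h
  have hbot : ¬ ((2 * Real.logb 2 s : ℝ) : EReal) ≤ ⊥ := by
    rw [le_bot_iff]; exact EReal.coe_ne_bot _
  -- In `EReal` any sum with `⊥` is `⊥`, even `⊤ + ⊥`, so a nonpositive x contradicts the real lower
  -- bound on H.
  by_cases hx : x ≤ 0
  · rw [log2, log2, if_pos hx, EReal.mul_bot_of_pos two_pos, EReal.add_bot] at h
    exact absurd h hbot
  push Not at hx
  refine ⟨hx, ?_⟩
  rw [log2, log2, if_neg hd.not_ge, if_neg hx.not_ge] at h
  induction S with
  | bot =>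
    rw [EReal.neg_bot, EReal.sub_top, EReal.bot_sub, EReal.bot_add] at h
    exact absurd h hbot
  | top => exact EReal.coe_lt_top _
  | coe r =>
    have h2 : (2 : EReal) = ((2 : ℝ) : EReal) := rfl
    rw [h2, ← EReal.coe_neg, ← EReal.coe_sub, ← EReal.coe_one, ← EReal.coe_sub, ← EReal.coe_mul,
      ← EReal.coe_add, EReal.coe_le_coe_iff] at h
    rw [EReal.coe_lt_coe_iff]
    -- The summand -1 is what makes the inequality strict.
    linarith

theorem mul_sqrt_rpow_neg_le {s d x l : ℝ} (hs : 0 < s) (hd : 0 < d) (hx : 0 < x)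
    (h : 2 * Real.logb 2 s - Real.logb 2 d - 2 * Real.logb 2 x < l) :
    s * (d⁻¹ * (Real.sqrt d * Real.sqrt ((2 : ℝ) ^ (-l)))) ≤ x := by
  have h1 : Real.logb 2 (d * x ^ 2 / s ^ 2) =
      Real.logb 2 d + 2 * Real.logb 2 x - 2 * Real.logb 2 s := by
    rw [Real.logb_div (by positivity) (by positivity), Real.logb_mul hd.ne' (by positivity),
      Real.logb_pow, Real.logb_pow]
    push_cast
    ring
  have h2 : (2 : ℝ) ^ (-l) < d * x ^ 2 / s ^ 2 := by
    rw [← Real.lt_logb_iff_rpow_lt one_lt_two (by positivity), h1]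
    linarith
  rw [← Real.sqrt_mul hd.le]
  have h3 : Real.sqrt (d * (2 : ℝ) ^ (-l)) ≤ d * x / s := by
    apply Real.sqrt_le_iff.2 ⟨by positivity, ?_⟩
    calc d * (2 : ℝ) ^ (-l) ≤ d * (d * x ^ 2 / s ^ 2) := mul_le_mul_of_nonneg_left h2.le hd.le
      _ = _ := by ring
  calc _ ≤ s * (d⁻¹ * (d * x / s)) := by gcongr
    _ = x := by field_simp

end OneShot

/-! ### The coding theorem. -/

theorem corollary5 {A B M : Type*}
    [Fintype A] [DecidableEq A] [Fintype B] [DecidableEq B] [Fintype M] [DecidableEq M]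
    (T : Matrix A A ℂ →ₗ[ℂ] Matrix B B ℂ) (hT : OneShot.IsCQChannel T)
    (hM : Fintype.card M ≤ Fintype.card A)
    (p : M → ℝ) (hp0 : ∀ m, 0 ≤ p m) (hp1 : ∑ m, p m = 1)
    (pe : ℝ) (hpe : 0 ≤ pe)
    (h : ∃ ε : ℝ, 0 ≤ ε ∧ ε ≤ pe ^ 2 / 8 ∧
      OneShot.maxEntropyOfDistribution p ≤
        OneShot.log2 (Fintype.card A) - OneShot.smoothMaxEntropy ε (OneShot.choi T) - 1
          + 2 * OneShot.log2 (pe ^ 2 - 8 * ε)) :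
    ∃ (E : Matrix M M ℂ →ₗ[ℂ] Matrix A A ℂ) (D : Matrix B B ℂ →ₗ[ℂ] Matrix M M ℂ),
      OneShot.IsChannel E ∧ OneShot.IsChannel D ∧
      OneShot.errorProbability p E T D ≤ pe := by
  obtain ⟨ε, hε, -, h⟩ := h
  have hMne : Nonempty M := by
    by_contra hM'
    rw [not_nonempty_iff] at hM'
    simp at hp1
  have hAne : Nonempty A := Fintype.card_pos_iff.1 (Fintype.card_pos.trans_le hM)
  have hd : (0 : ℝ) < Fintype.card A := Nat.cast_pos.2 Fintype.card_pos
  have hs := OneShot.sum_sqrt_pos hp0 hp1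
  have hρ := OneShot.isState_outputState hT.1
  obtain ⟨hx, hlt⟩ := OneShot.lt_smoothMinEntropy hd
    (OneShot.le_maxEntropyOfDistribution hp0 hp1) h
  rw [OneShot.smoothMinEntropy] at hlt
  -- Strictness yields actual τ, σ and l, so no supremum has to be attained.
  simp only [lt_iSup_iff, OneShot.minEntropy] at hlt
  obtain ⟨τ, hτ, hτd, σ, hσ, l, hl, hlt⟩ := hlt
  rw [OneShot.choi_eq_fstBlock hT.2] at hτd
  obtain ⟨K, hK1, hK2, hK3⟩ := OneShot.exists_smoothed_amplitude hρ hτ hτd hσ hl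
  obtain ⟨f, Q, hQ, hQ1, hle⟩ := OneShot.exists_code hρ hε hK1 hK2 hK3 hp0 hp1
  have hsingle : ∀ m : M, (Matrix.single m m (1 : ℂ)).PosSemidef := fun m => by
    rw [← Matrix.diagonal_single]
    exact Matrix.PosSemidef.diagonal (Pi.single_nonneg.2 zero_le_one)
  refine ⟨OneShot.measurePrepare (fun m : M => Matrix.single m m (1 : ℂ)) f,
    OneShot.measurePrepare Q id,
    OneShot.isChannel_measurePrepare hsingle (by simp [Matrix.sum_single_one]) f,
    OneShot.isChannel_measurePrepare hQ hQ1 id, ?_⟩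
  rw [OneShot.errorProbability_eq hT.1 hp0 f hQ hQ1]
  -- For p_e ≥ 1 any code will do; otherwise the bound (p_e² - 8ε) + 3ε is at most p_e² ≤ p_e.
  by_cases hpe1 : 1 ≤ pe
  · refine le_trans ?_ hpe1
    rw [← hp1]
    refine Finset.sum_le_sum fun m _ => ?_
    have := OneShot.trace_mul_re_nonneg (hQ m) (hρ (f m)).1
    nlinarith [hp0 m]
  · have h1 := OneShot.mul_sqrt_rpow_neg_le hs hd hx (EReal.coe_lt_coe_iff.1 hlt)
    have h2 : pe ^ 2 ≤ pe := by nlinarith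
    linarith
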